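/- Lemma 1.2. Let $G$ be a nontrivial divisible (linearly) ordered abelian group which is $\aleph_1$-saturated as a structure in the language $\{+,-,0,<\}$. Let $K=\mathbb R((G))$ be the Hahn series field of formal sums $f=\sum_{g\in G}a_g t^g$ with $a_g\in\mathbb R$ and well-ordered support $\{g\in G: a_g\neq 0\}$, with componentwise addition, the convolution product, and the lexicographic order ($f>0$ if and only if $f\ne 0$ and the coefficient of $f$ at the least element of its support is positive). Then $K$ is a real closed field and it is $\aleph_1$-saturated as a structure in the language $\{+,\cdot,-,0,1,<\}$. Here a structure $M$ is $\aleph_1$-saturated if for every countable $A\subseteq M$, every set of first-order formulas in one free variable with parameters from $A$ that is finitely satisfiable in $M$ is realized by an element of $M$. -/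

import Mathlib

namespace OrderedStructures

open FirstOrder

universe u v w

/-- The only relation symbol of our languages: a binary symbol `<`. -/
inductive ltRel : ℕ → Type
  | lt : ltRel 2

/-- The function symbols `0`, `-`, `+` of the language of ordered groups. -/
inductive groupFunc : ℕ → Type
  | zero : groupFunc 0
  | neg : groupFunc 1
  | add : groupFunc 2

/-- The first-order language `{+, -, 0, <}` of ordered (additive) groups. -/
def orderedGroupLang : FirstOrder.Language.{0, 0} where
  Functions := groupFunc
  Relations := ltRel

/-- The first-order language `{+, ·, -, 0, 1, <}` of ordered rings and ordered fields; the function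
symbols are those of Mathlib's language of rings. -/
def orderedRingLang : FirstOrder.Language.{0, 0} where
  Functions := ringFunc
  Relations := ltRel

/-- A type with `+`, `-`, `0`, `<` as a structure for the language of ordered groups. -/
instance orderedGroupStructure (G : Type u) [Add G] [Neg G] [Zero G] [LT G] :
    orderedGroupLang.Structure G where
  funMap := fun {_} f =>
    match f with
    | .zero => fun _ => 0
    | .neg => fun x => -x 0
    | .add => fun x => x 0 + x 1
  RelMap := fun {_} r =>
    match r with
    | .lt => fun x => x 0 < x 1

/-- A type with `+`, `·`, `-`, `0`, `1`, `<` as a structure for the language of ordered rings. -/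
instance orderedRingStructure (R : Type u) [Add R] [Mul R] [Neg R] [Zero R] [One R] [LT R] :
    orderedRingLang.Structure R where
  funMap := fun {_} f =>
    match f with
    | .add => fun x => x 0 + x 1
    | .mul => fun x => x 0 * x 1
    | .neg => fun x => -x 0
    | .zero => fun _ => 0
    | .one => fun _ => 1
  RelMap := fun {_} r =>
    match r with
    | .lt => fun x => x 0 < x 1

/-- An `L`-structure `M` is `κ`-saturated if for every set of parameters `A ⊆ M` with `|A| < κ`,
every set `p` of `L`-formulas in one free variable with parameters from `A` that is finitely
satisfiable in `M` (that is, every type over `A`) is realized by an element of `M`. -/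
def IsSaturated (κ : Cardinal.{w}) (L : FirstOrder.Language.{u, v}) (M : Type w) [L.Structure M] : Prop :=
  ∀ A : Set M, Cardinal.mk A < κ → ∀ p : Set (L[[A]].Formula (Fin 1)),
    (∀ s : Finset (L[[A]].Formula (Fin 1)), (s : Set (L[[A]].Formula (Fin 1))) ⊆ p →
      ∃ x : M, ∀ φ ∈ s, φ.Realize (fun _ => x)) →
    ∃ x : M, ∀ φ ∈ p, φ.Realize (fun _ => x)

end OrderedStructures

set_option linter.unusedSectionVars false

namespace OrderedStructures

open Polynomial

/-! Over an ordered field with the intermediate value property for polynomials, the truth of a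
formula depends only on the signs of finitely many polynomials (`exists_finite_signs`, a quantifier
elimination by sign tables). A type over a countable set therefore concerns only the position of a
point relative to countably many roots, so the field is ℵ₁-saturated as soon as two countable sets,
one below the other, can always be separated by an element (`isSaturated_of_countableCutProperty`).

For Hahn series, both the intermediate value property and the separation of countable sets come from
one analysis of cuts. Every cut has a center `x` (`exists_center`): glue the coefficients on which
close points from the two sides agree, and if necessary add one real multiple of a monomial. On the
side of `x` where the cut lies, the side of the cut on which a point falls depends only on the
valuation of its distance to `x`, so the cut comes from a cut of `G`.

Separation: saturation of `G` yields an exponent `γ` between two countable sets of valuations, and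
`x ± t ^ γ` separates the given sets (`countableCutProperty_hahn`). Intermediate values: expand the
polynomial around `x`. Divisibility of `G` gives a monomial at which two given terms have equal
valuation; the cut does not split the valuation class of that monomial, so one of the terms
dominates near the cut. Hence a single term dominates all others there, and the polynomial cannot
change sign (`polyIVT_hahn`). Real closedness is a consequence. -/

/-- The intermediate value property for polynomials over an ordered field. -/
def PolyIVT (K : Type*) [Field K] [LinearOrder K] : Prop :=
  ∀ (f : K[X]) (a b : K), a < b → f.eval a < 0 → 0 < f.eval b → ∃ c, a < c ∧ c < b ∧ f.eval c = 0

/-! ### Rolle, monotonicity and real closedness from the intermediate value property. -/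

section PolyIVT

variable {K : Type*} [Field K] [LinearOrder K] [IsStrictOrderedRing K]

theorem PolyIVT.exists_root (h : PolyIVT K) {f : K[X]} {a b : K} (hab : a < b)
    (hf : f.eval a * f.eval b < 0) : ∃ c, a < c ∧ c < b ∧ f.eval c = 0 := by
  rcases mul_neg_iff.1 hf with ⟨h1, h2⟩ | ⟨h1, h2⟩
  · obtain ⟨c, hc⟩ := h (-f) a b hab (by simpa using h1) (by simpa using h2)
    exact ⟨c, by simpa using hc⟩
  · exact h f a b hab h1 h2

theorem PolyIVT.mul_pos_of_no_root (h : PolyIVT K) {f : K[X]} {a b : K} (hab : a ≤ b)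
    (hf : ∀ c, a ≤ c → c ≤ b → f.eval c ≠ 0) : 0 < f.eval a * f.eval b := by
  rcases hab.eq_or_lt with rfl | hab
  · exact mul_self_pos.2 (hf a le_rfl le_rfl)
  · by_contra hn
    have : f.eval a * f.eval b < 0 := lt_of_le_of_ne (not_lt.1 hn)
      (mul_ne_zero (hf a le_rfl hab.le) (hf b hab.le le_rfl))
    obtain ⟨c, h1, h2, h3⟩ := h.exists_root hab this
    exact hf c h1.le h2.le h3

theorem sign_eq_of_mul_pos {x y : K} (h : 0 < x * y) : SignType.sign x = SignType.sign y := by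
  rcases mul_pos_iff.1 h with ⟨h1, h2⟩ | ⟨h1, h2⟩
  · rw [sign_pos h1, sign_pos h2]
  · rw [sign_neg h1, sign_neg h2]

theorem PolyIVT.sign_eq_of_no_root (h : PolyIVT K) {f : K[X]} {a b : K} (hab : a ≤ b)
    (hf : ∀ c, a ≤ c → c ≤ b → f.eval c ≠ 0) :
    SignType.sign (f.eval a) = SignType.sign (f.eval b) :=
  sign_eq_of_mul_pos (h.mul_pos_of_no_root hab hf)

/-- Rolle's theorem between two consecutive roots. -/
theorem PolyIVT.rolle_consecutive (h : PolyIVT K) {f : K[X]} {a b : K} (hab : a < b)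
    (ha : f.eval a = 0) (hb : f.eval b = 0) (hf : ∀ c, a < c → c < b → f.eval c ≠ 0) :
    ∃ c, a < c ∧ c < b ∧ f.derivative.eval c = 0 := by
  have hf0 : f ≠ 0 := by
    rintro rfl
    obtain ⟨c, h1, h2⟩ := exists_between hab
    exact hf c h1 h2 (by simp)
  obtain ⟨g, hg, hga⟩ := exists_eq_pow_rootMultiplicity_mul_and_not_dvd f hf0 a
  set m := rootMultiplicity a f
  have hm : 0 < m := (rootMultiplicity_pos hf0).2 ha
  have hg0 : g ≠ 0 := by rintro rfl; simp at hga
  obtain ⟨k, hk, hkb⟩ := exists_eq_pow_rootMultiplicity_mul_and_not_dvd g hg0 b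
  set n := rootMultiplicity b g
  have hgb : g.eval b = 0 := by
    have h2 := hb
    rw [hg, eval_mul, mul_eq_zero] at h2
    refine h2.resolve_left ?_
    simp [sub_ne_zero.2 hab.ne']
  have hn : 0 < n := (rootMultiplicity_pos hg0).2 hgb
  have hka : k.eval a ≠ 0 := by
    intro h0
    exact hga (by rw [hk]; exact (dvd_iff_isRoot.2 h0).mul_left _)
  have hkb' : k.eval b ≠ 0 := fun h0 => hkb (dvd_iff_isRoot.2 h0)
  -- From here on `m` and `n` are the multiplicities of the two roots minus one.
  obtain ⟨m, hm'⟩ : ∃ m', m = m' + 1 := ⟨m - 1, by omega⟩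
  obtain ⟨n, hn'⟩ : ∃ n', n = n' + 1 := ⟨n - 1, by omega⟩
  rw [hk, hn', hm'] at hg
  -- This is the derivative stripped of its forced factors at `a` and `b`. At each end point one
  -- summand survives, and `a - b` and `b - a` give these opposite signs because `k` has no root in
  -- between.
  set q : K[X] := C ((m : K) + 1) * (X - C b) * k + C ((n : K) + 1) * (X - C a) * k
    + (X - C a) * (X - C b) * derivative k with hq
  have hd : derivative f = (X - C a) ^ m * (X - C b) ^ n * q := by
    rw [hg, hq]
    simp only [derivative_mul, derivative_X_sub_C_pow, Nat.cast_add, Nat.cast_one,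
      add_tsub_cancel_right, C_add, C_1, map_natCast]
    ring
  have hkk : 0 < k.eval a * k.eval b := by
    refine h.mul_pos_of_no_root hab.le fun c hc1 hc2 h0 => ?_
    rcases hc1.eq_or_lt with rfl | hc1
    · exact hka h0
    rcases hc2.eq_or_lt with rfl | hc2
    · exact hkb' h0
    exact hf c hc1 hc2 (by rw [hg]; simp [h0])
  have hqq : q.eval a * q.eval b < 0 := by
    have e1 : q.eval a = ((m : K) + 1) * (a - b) * k.eval a := by simp [hq]
    have e2 : q.eval b = ((n : K) + 1) * (b - a) * k.eval b := by simp [hq]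
    have e3 : q.eval a * q.eval b
        = -(((m : K) + 1) * ((n : K) + 1) * ((b - a) * (b - a)) * (k.eval a * k.eval b)) := by
      rw [e1, e2]; ring
    have : 0 < b - a := sub_pos.2 hab
    rw [e3]
    have : 0 < ((m : K) + 1) * ((n : K) + 1) * ((b - a) * (b - a)) * (k.eval a * k.eval b) := by
      positivity
    linarith
  obtain ⟨c, h1, h2, h3⟩ := h.exists_root hab hqq
  exact ⟨c, h1, h2, by rw [hd]; simp [h3]⟩

/-- A nonzero polynomial has finitely many roots, so `b` can be replaced by the least root above
`a`. -/
theorem PolyIVT.rolle (h : PolyIVT K) {f : K[X]} {a b : K} (hab : a < b)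
    (ha : f.eval a = 0) (hb : f.eval b = 0) :
    ∃ c, a < c ∧ c < b ∧ f.derivative.eval c = 0 := by
  classical
  by_cases hf0 : f = 0
  · obtain ⟨c, h1, h2⟩ := exists_between hab
    exact ⟨c, h1, h2, by simp [hf0]⟩
  have hne : (f.roots.toFinset.filter (fun x => a < x)).Nonempty :=
    ⟨b, by simp [hf0, hb, hab]⟩
  obtain ⟨b', hb', hmin⟩ := Finset.exists_min_image _ id hne
  simp only [Finset.mem_filter, Multiset.mem_toFinset, mem_roots hf0, IsRoot.def, id] at hb' hmin
  have hbb : b' ≤ b := hmin b ⟨hb, hab⟩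
  obtain ⟨c, h1, h2, h3⟩ := h.rolle_consecutive hb'.2 ha hb'.1
    fun c h1 h2 h0 => absurd (hmin c ⟨h0, h1⟩) (not_le.2 h2)
  exact ⟨c, h1, h2.trans_le hbb, h3⟩

theorem PolyIVT.mean_value (h : PolyIVT K) (f : K[X]) {a b : K} (hab : a < b) :
    ∃ c, a < c ∧ c < b ∧ f.eval b - f.eval a = f.derivative.eval c * (b - a) := by
  have hba : b - a ≠ 0 := (sub_pos.2 hab).ne'
  obtain ⟨c, h1, h2, h3⟩ := h.rolle
    (f := f - C ((f.eval b - f.eval a) / (b - a)) * (X - C a) - C (f.eval a)) hab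
    (by simp) (by simp; field_simp; ring)
  refine ⟨c, h1, h2, ?_⟩
  simp at h3
  rw [sub_eq_zero.1 h3]
  field_simp

theorem PolyIVT.strictMonoOn (h : PolyIVT K) {f : K[X]} {a b : K}
    (hf : ∀ c, a < c → c < b → 0 < f.derivative.eval c) :
    StrictMonoOn (fun x => f.eval x) (Set.Icc a b) := by
  intro x hx y hy hxy
  obtain ⟨c, h1, h2, h3⟩ := h.mean_value f hxy
  have := mul_pos (hf c (hx.1.trans_lt h1) (h2.trans_le hy.2)) (sub_pos.2 hxy)
  simp only
  linarith

/-- Horner induction on the degree, through `f = divX * X + f(0)`. For `c ≥ 1` multiplying by `c`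
does not decrease the value of `divX`, so a lower bound `|M - f(0)|` for it suffices. -/
theorem eventually_le_eval (n : ℕ) (f : K[X]) (hn : f.natDegree = n + 1)
    (hf : 0 < f.leadingCoeff) (M : K) : ∃ B, ∀ c, B ≤ c → M ≤ f.eval c := by
  induction n generalizing f M with
  | zero =>
    rw [leadingCoeff, hn] at hf
    refine ⟨(M - f.coeff 0) / f.coeff 1, fun c hc => ?_⟩
    rw [div_le_iff₀ hf] at hc
    rw [eval_eq_sum_range, hn]
    simp [Finset.sum_range_succ]
    linarith [mul_comm c (f.coeff 1)]
  | succ n ih =>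
    have hd : f.divX.natDegree = n + 1 := by rw [natDegree_divX_eq_natDegree_tsub_one, hn]; rfl
    have hl : 0 < f.divX.leadingCoeff := by
      rw [leadingCoeff, hd, coeff_divX]
      rwa [leadingCoeff, hn] at hf
    obtain ⟨B, hB⟩ := ih f.divX hd hl |M - f.coeff 0|
    refine ⟨max B 1, fun c hc => ?_⟩
    have h1 := hB c ((le_max_left _ _).trans hc)
    have h2 : 1 ≤ c := (le_max_right _ _).trans hc
    have h3 : f.eval c = f.divX.eval c * c + f.coeff 0 := by
      conv_lhs => rw [← divX_mul_X_add f]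
      simp
    rw [h3]
    have h4 := le_abs_self (M - f.coeff 0)
    have h5 : 0 ≤ f.divX.eval c := (abs_nonneg _).trans h1
    nlinarith

theorem eventually_sign_eval (f : K[X]) :
    ∃ B, ∀ c, B ≤ c → SignType.sign (f.eval c) = SignType.sign f.leadingCoeff := by
  have key : ∀ f : K[X], 0 < f.leadingCoeff → ∃ B, ∀ c, B ≤ c → 0 < f.eval c := by
    intro f hf
    rcases Nat.eq_zero_or_eq_succ_pred f.natDegree with h0 | h0
    · refine ⟨0, fun c _ => ?_⟩
      rw [eq_C_of_natDegree_eq_zero h0, eval_C]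
      rwa [leadingCoeff, h0] at hf
    · obtain ⟨B, hB⟩ := eventually_le_eval _ f h0 hf 1
      exact ⟨B, fun c hc => one_pos.trans_le (hB c hc)⟩
  rcases lt_trichotomy f.leadingCoeff 0 with h | h | h
  · obtain ⟨B, hB⟩ := key (-f) (by simpa using h)
    exact ⟨B, fun c hc => by rw [sign_neg h, sign_neg (by simpa using hB c hc)]⟩
  · exact ⟨0, fun c _ => by simp [leadingCoeff_eq_zero.1 h]⟩
  · obtain ⟨B, hB⟩ := key f h
    exact ⟨B, fun c hc => by rw [sign_pos h, sign_pos (hB c hc)]⟩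

/-- Square roots are roots of `X ^ 2 - x` in the interval from `0` to `x + 1`. A polynomial of odd
degree has opposite signs far to the left and far to the right; substituting `-X` reads off the left
end. -/
theorem PolyIVT.isRealClosed (h : PolyIVT K) : IsRealClosed K := by
  refine IsRealClosed.of_linearOrderedField (fun {x} hx => ?_) (fun {f} hf => ?_)
  · rcases hx.eq_or_lt with rfl | hx
    · exact ⟨0, by simp⟩
    obtain ⟨c, -, -, hc⟩ := h (X ^ 2 - C x) 0 (x + 1) (by linarith) (by simpa using hx)
      (by simp; nlinarith)
    exact ⟨c, by simp at hc; linear_combination -hc⟩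
  · have hf0 : f.leadingCoeff ≠ 0 := by
      rw [leadingCoeff_ne_zero]
      rintro rfl
      simp at hf
    obtain ⟨B, hB⟩ := eventually_sign_eval f
    obtain ⟨B', hB'⟩ := eventually_sign_eval (f.comp (-X))
    have h1 := hB (max (max B B') 1) ((le_max_left _ _).trans (le_max_left _ _))
    have h2 := hB' (max (max B B') 1) ((le_max_right _ _).trans (le_max_left _ _))
    have h3 : (f.comp (-X)).leadingCoeff = - f.leadingCoeff := by
      rw [leadingCoeff_comp (by simp)]; simp [hf.neg_one_pow]
    rw [h3, Left.sign_neg, eval_comp, eval_neg, eval_X] at h2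
    have h5 : 1 ≤ max (max B B') 1 := le_max_right _ _
    obtain ⟨c, -, -, hc⟩ := h.exists_root (f := f) (a := -(max (max B B') 1))
      (b := max (max B B') 1) (by linarith) (by
        rcases lt_or_gt_of_ne hf0 with h0 | h0
        · rw [sign_neg h0] at h1 h2
          exact mul_neg_of_pos_of_neg (sign_eq_one_iff.1 (by simpa using h2))
            (sign_eq_neg_one_iff.1 h1)
        · rw [sign_pos h0] at h1 h2
          exact mul_neg_of_neg_of_pos (sign_eq_neg_one_iff.1 h2) (sign_eq_one_iff.1 h1))
    exact ⟨c, hc⟩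

end PolyIVT

end OrderedStructures

/-! ### Pseudo-division and finite closures of sets of polynomials. -/

namespace OrderedStructures

open Polynomial

section Closure

variable {R : Type*} [CommRing R]

/-- The coefficients will be specialized by varying ring homomorphisms, so the leading coefficient
of `p` cannot be inverted; each division step multiplies by it instead. -/
theorem exists_pseudo_rem (p q : R[X]) (hp : 0 < p.natDegree) :
    ∃ (k : ℕ) (s r : R[X]), C p.leadingCoeff ^ k * q = s * p + r ∧ r.natDegree < p.natDegree := by
  induction hn : q.natDegree using Nat.strong_induction_on generalizing q with
  | _ n ih =>
    by_cases hlt : q.natDegree < p.natDegree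
    · exact ⟨0, 0, q, by simp, hlt⟩
    push Not at hlt
    set q' := C p.leadingCoeff * q - C q.leadingCoeff * X ^ (q.natDegree - p.natDegree) * p with hq'
    have hdeg : q'.natDegree < n := by
      have hle : q'.natDegree ≤ n := by
        refine (natDegree_sub_le _ _).trans (max_le ?_ ?_)
        · exact (natDegree_C_mul_le _ _).trans hn.le
        · refine natDegree_mul_le.trans ?_
          have := natDegree_C_mul_X_pow_le q.leadingCoeff (q.natDegree - p.natDegree)
          omega
      refine lt_of_le_of_ne hle fun heq => ?_
      have hc : q'.coeff n = 0 := by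
        have e : n = p.natDegree + (q.natDegree - p.natDegree) := by omega
        rw [hq', coeff_sub, coeff_C_mul, mul_assoc, coeff_C_mul]
        conv_lhs => enter [2]; rw [e, coeff_X_pow_mul]
        rw [coeff_natDegree, ← hn, coeff_natDegree]
        ring
      rw [← heq, coeff_natDegree, leadingCoeff_eq_zero] at hc
      rw [hc] at heq
      simp at heq
      omega
    obtain ⟨k, s, r, h1, h2⟩ := ih _ hdeg q' rfl
    refine ⟨k + 1, s + C p.leadingCoeff ^ k * (C q.leadingCoeff * X ^ (q.natDegree - p.natDegree)),
      r, ?_, h2⟩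
    rw [hq'] at h1
    linear_combination h1

/-- A choice of pseudo-remainder of `q` modulo `p`. -/
noncomputable def pseudoRem (p q : R[X]) : R[X] :=
  open Classical in
  if hp : 0 < p.natDegree then (exists_pseudo_rem p q hp).choose_spec.choose_spec.choose else 0

theorem pseudoRem_spec (p q : R[X]) (hp : 0 < p.natDegree) :
    ∃ (k : ℕ) (s : R[X]), C p.leadingCoeff ^ k * q = s * p + pseudoRem p q := by
  rw [pseudoRem, dif_pos hp]
  exact ⟨_, _, (exists_pseudo_rem p q hp).choose_spec.choose_spec.choose_spec.1⟩

theorem natDegree_pseudoRem_lt (p q : R[X]) (hp : 0 < p.natDegree) :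
    (pseudoRem p q).natDegree < p.natDegree := by
  rw [pseudoRem, dif_pos hp]
  exact (exists_pseudo_rem p q hp).choose_spec.choose_spec.choose_spec.2

/-- The closure of a set of polynomials under derivatives, truncations and pseudo-remainders. -/
inductive RemClosure (S : Set R[X]) : R[X] → Prop
  | base {p} : p ∈ S → RemClosure S p
  | deriv {p} : RemClosure S p → 0 < p.natDegree → RemClosure S (derivative p)
  | erase {p} : RemClosure S p → 0 < p.natDegree → RemClosure S p.eraseLead
  | rem {p q} : RemClosure S p → RemClosure S q → 0 < p.natDegree → p.natDegree ≤ q.natDegree →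
      RemClosure S (pseudoRem p q)

theorem natDegree_eraseLead_lt' {p : R[X]} (hp : 0 < p.natDegree) :
    p.eraseLead.natDegree < p.natDegree := by
  have := eraseLead_natDegree_le p
  omega

/-- Each operation returns a degree strictly below that of all its inputs; for remainders this uses
`p.natDegree ≤ q.natDegree`. With degrees bounded by `d`, descending induction on the degree shows
that every layer is finite. -/
theorem finite_remClosure {S : Set R[X]} (hS : S.Finite) : {p | RemClosure S p}.Finite := by
  obtain ⟨d, hd⟩ : ∃ d, ∀ p ∈ S, p.natDegree < d := by
    obtain ⟨d, hd⟩ := (hS.image natDegree).bddAbove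
    exact ⟨d + 1, fun p hp => Nat.lt_succ_of_le (hd ⟨p, hp, rfl⟩)⟩
  have hbound : ∀ p, RemClosure S p → p.natDegree < d := by
    intro p hp
    induction hp with
    | base h => exact hd _ h
    | deriv _ h ih => exact (natDegree_derivative_lt h.ne').trans ih
    | erase _ h ih => exact (natDegree_eraseLead_lt' h).trans ih
    | rem _ _ h _ ih _ => exact (natDegree_pseudoRem_lt _ _ h).trans ih
  have key : ∀ k, {p | RemClosure S p ∧ d ≤ p.natDegree + k}.Finite := by
    intro k
    induction k with
    | zero =>
      refine Set.finite_empty.subset ?_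
      rintro p ⟨h1, h2⟩
      exact absurd (hbound p h1) (not_lt.2 h2)
    | succ k ih =>
      refine (hS.union ((ih.image derivative).union ((ih.image eraseLead).union
        (Set.Finite.image2 pseudoRem ih ih)))).subset ?_
      rintro p ⟨h1, h2⟩
      cases h1 with
      | base h => exact Or.inl h
      | @deriv p h h' =>
        exact Or.inr (Or.inl ⟨p, ⟨h, by have := natDegree_derivative_lt h'.ne'; omega⟩, rfl⟩)
      | @erase p h h' =>
        exact Or.inr (Or.inr (Or.inl ⟨p, ⟨h, by have := natDegree_eraseLead_lt' h'; omega⟩, rfl⟩))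
      | @rem p q h h' h3 h4 =>
        have := natDegree_pseudoRem_lt p q h3
        exact Or.inr (Or.inr (Or.inr ⟨p, ⟨h, by omega⟩, q, ⟨h', by omega⟩, rfl⟩))
  exact (key d).subset fun p hp => ⟨hp, by omega⟩

end Closure

/-! ### Sign tables and comparison of signs of monotone polynomials. -/

section Table

variable {K : Type*} [Field K] [LinearOrder K] [IsStrictOrderedRing K]

/-- `c` and `d` occupy the same position relative to the matched points in `L`. -/
def SamePosition (L : Finset (K × K)) (c d : K) : Prop :=
  ∀ u ∈ L, (u.1 < c ↔ u.2 < d) ∧ (c < u.1 ↔ d < u.2)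

/-- A sign table for a set `Q` of pairs of polynomials: a finite matching `L` between points of
`[a, b]` and points of `[a', b']` such that points in the same position with respect to `L` give the
same signs to the components of each pair, and `L` lists the roots. -/
structure IsSignTable (a b a' b' : K) (L : Finset (K × K)) (Q : Set (K[X] × K[X])) : Prop where
  left_mem : (a, a') ∈ L
  right_mem : (b, b') ∈ L
  mem_Icc : ∀ u ∈ L, (a ≤ u.1 ∧ u.1 ≤ b) ∧ (a' ≤ u.2 ∧ u.2 ≤ b')
  lt_iff : ∀ u ∈ L, ∀ v ∈ L, (u.1 < v.1 ↔ u.2 < v.2)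
  sign_eq : ∀ c d, a ≤ c → c ≤ b → a' ≤ d → d ≤ b' → SamePosition L c d → ∀ P ∈ Q,
    SignType.sign (P.1.eval c) = SignType.sign (P.2.eval d)
  roots_left : ∀ P ∈ Q, P.1 ≠ 0 → ∀ c, a ≤ c → c ≤ b → P.1.eval c = 0 → ∃ u ∈ L, u.1 = c
  roots_right : ∀ P ∈ Q, P.2 ≠ 0 → ∀ d, a' ≤ d → d ≤ b' → P.2.eval d = 0 → ∃ u ∈ L, u.2 = d

theorem exists_eq_or_adjacent {ι : Type*} (L : Finset ι) (x : ι → K) {c : K} {i j : ι} (hi : i ∈ L)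
    (hj : j ∈ L) (hic : x i ≤ c) (hcj : c ≤ x j) :
    (∃ u ∈ L, x u = c) ∨ ∃ u ∈ L, ∃ w ∈ L, x u < c ∧ c < x w ∧ ∀ v ∈ L, x v ≤ x u ∨ x w ≤ x v := by
  by_cases hc : ∃ u ∈ L, x u = c
  · exact Or.inl hc
  push Not at hc
  right
  obtain ⟨u, hu, hu'⟩ := Finset.exists_max_image (L.filter fun v => x v < c) x
    ⟨i, by simp [hi, lt_of_le_of_ne hic (hc i hi)]⟩
  obtain ⟨w, hw, hw'⟩ := Finset.exists_min_image (L.filter fun v => c < x v) x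
    ⟨j, by simp [hj, lt_of_le_of_ne hcj (hc j hj).symm]⟩
  simp only [Finset.mem_filter] at hu hw hu' hw'
  refine ⟨u, hu.1, w, hw.1, hu.2, hw.2, fun v hv => ?_⟩
  rcases lt_or_gt_of_ne (hc v hv) with h | h
  · exact Or.inl (hu' v ⟨hv, h⟩)
  · exact Or.inr (hw' v ⟨hv, h⟩)

theorem SamePosition.eq {L : Finset (K × K)} {c d : K} (h : SamePosition L c d) {u : K × K}
    (hu : u ∈ L) : u.1 = c ↔ u.2 = d := by
  have := h u hu
  constructor <;> intro e
  · rw [e] at this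
    exact le_antisymm (not_lt.1 fun h' => lt_irrefl _ (this.2.2 h'))
      (not_lt.1 fun h' => lt_irrefl _ (this.1.2 h'))
  · rw [e] at this
    exact le_antisymm (not_lt.1 fun h' => lt_irrefl _ (this.2.1 h'))
      (not_lt.1 fun h' => lt_irrefl _ (this.1.1 h'))

theorem SamePosition.mono {L L' : Finset (K × K)} (hL : L ⊆ L') {c d : K}
    (h : SamePosition L' c d) : SamePosition L c d := fun u hu => h u (hL hu)

/-- Matching of the root of a strictly increasing polynomial on two intervals. -/
theorem PolyIVT.root_transfer (h : PolyIVT K) {f g : K[X]} {p q p' q' : K} (hpq' : p' < q')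
    (hf : StrictMonoOn (fun x => f.eval x) (Set.Icc p q))
    (hp : SignType.sign (f.eval p) = SignType.sign (g.eval p'))
    (hq : SignType.sign (f.eval q) = SignType.sign (g.eval q'))
    {z : K} (h1 : p < z) (h2 : z < q) (hz : f.eval z = 0) :
    ∃ z', p' < z' ∧ z' < q' ∧ g.eval z' = 0 := by
  have e1 : f.eval p < 0 := hz ▸ hf ⟨le_rfl, (h1.trans h2).le⟩ ⟨h1.le, h2.le⟩ h1
  have e2 : 0 < f.eval q := hz ▸ hf ⟨h1.le, h2.le⟩ ⟨(h1.trans h2).le, le_rfl⟩ h2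
  rw [sign_neg e1, eq_comm, sign_eq_neg_one_iff] at hp
  rw [sign_pos e2, eq_comm, sign_eq_one_iff] at hq
  exact h g p' q' hpq' hp hq

/-- Opposite signs at `c` and `d` force roots lying on opposite sides of these points. This
contradicts `c` and `d` having the same position relative to the roots, which is how
`PolyIVT.sign_transfer` uses it. -/
theorem PolyIVT.not_neg_pos (h : PolyIVT K) {f g : K[X]} {p q p' q' : K}
    (hf : StrictMonoOn (fun x => f.eval x) (Set.Icc p q))
    (hg : StrictMonoOn (fun x => g.eval x) (Set.Icc p' q'))
    (hp : SignType.sign (f.eval p) = SignType.sign (g.eval p'))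
    (hq : SignType.sign (f.eval q) = SignType.sign (g.eval q'))
    {c d : K} (h1 : p < c) (h2 : c < q) (h1' : p' < d) (h2' : d < q')
    (hc : f.eval c < 0) (hd : 0 < g.eval d) :
    ∃ z z', (p < z ∧ z < q ∧ f.eval z = 0) ∧ (p' < z' ∧ z' < q' ∧ g.eval z' = 0) ∧
      c < z ∧ z' < d := by
  have e1 : f.eval p < 0 := (hf ⟨le_rfl, (h1.trans h2).le⟩ ⟨h1.le, h2.le⟩ h1).trans hc
  have e2 : 0 < g.eval q' := hd.trans (hg ⟨h1'.le, h2'.le⟩ ⟨(h1'.trans h2').le, le_rfl⟩ h2')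
  rw [sign_neg e1, eq_comm, sign_eq_neg_one_iff] at hp
  rw [sign_pos e2, sign_eq_one_iff] at hq
  obtain ⟨z, hz⟩ := h f c q h2 hc hq
  obtain ⟨z', hz'⟩ := h g p' d h1' hp hd
  exact ⟨z, z', ⟨h1.trans hz.1, hz.2⟩, ⟨hz'.1, hz'.2.1.trans h2', hz'.2.2⟩, hz.1, hz'.2.1⟩

/-- A strictly increasing polynomial has at most one root in the interval, and its sign is
determined by the position relative to that root. Equal signs at the end points ensure that both
roots exist or neither does. -/
theorem PolyIVT.sign_transfer (h : PolyIVT K) {f g : K[X]} {p q p' q' : K}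
    (hf : StrictMonoOn (fun x => f.eval x) (Set.Icc p q))
    (hg : StrictMonoOn (fun x => g.eval x) (Set.Icc p' q'))
    (hp : SignType.sign (f.eval p) = SignType.sign (g.eval p'))
    (hq : SignType.sign (f.eval q) = SignType.sign (g.eval q'))
    {c d : K} (h1 : p < c) (h2 : c < q) (h1' : p' < d) (h2' : d < q')
    (hz : ∀ z z', (p < z ∧ z < q ∧ f.eval z = 0) → (p' < z' ∧ z' < q' ∧ g.eval z' = 0) →
      (z < c ↔ z' < d) ∧ (c < z ↔ d < z')) :
    SignType.sign (f.eval c) = SignType.sign (g.eval d) := by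
  have hzero : f.eval c = 0 → g.eval d = 0 := by
    intro h0
    obtain ⟨z', hz'⟩ := h.root_transfer (h1'.trans h2') hf hp hq h1 h2 h0
    obtain ⟨e1, e2⟩ := hz c z' ⟨h1, h2, h0⟩ hz'
    have : z' = d := le_antisymm (not_lt.1 fun h' => lt_irrefl _ (e2.2 h'))
      (not_lt.1 fun h' => lt_irrefl _ (e1.2 h'))
    exact this ▸ hz'.2.2
  have hzero' : g.eval d = 0 → f.eval c = 0 := by
    intro h0
    obtain ⟨z, hz'⟩ := h.root_transfer (h1.trans h2) hg hp.symm hq.symm h1' h2' h0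
    obtain ⟨e1, e2⟩ := hz z d hz' ⟨h1', h2', h0⟩
    have : z = c := le_antisymm (not_lt.1 fun h' => lt_irrefl _ (e2.1 h'))
      (not_lt.1 fun h' => lt_irrefl _ (e1.1 h'))
    exact this ▸ hz'.2.2
  rcases lt_trichotomy (f.eval c) 0 with hc | hc | hc
  · rcases lt_trichotomy (g.eval d) 0 with hd | hd | hd
    · rw [sign_neg hc, sign_neg hd]
    · exact absurd (hzero' hd) hc.ne
    · obtain ⟨z, z', hz1, hz2, e1, e2⟩ := h.not_neg_pos hf hg hp hq h1 h2 h1' h2' hc hd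
      exact absurd ((hz z z' hz1 hz2).2.1 e1) e2.not_gt
  · rw [hc, hzero hc]
  · rcases lt_trichotomy (g.eval d) 0 with hd | hd | hd
    · obtain ⟨z', z, hz2, hz1, e1, e2⟩ :=
        h.not_neg_pos hg hf hp.symm hq.symm h1' h2' h1 h2 hd hc
      exact absurd ((hz z z' hz1 hz2).2.2 e1) e2.not_gt
    · exact absurd (hzero' hd) hc.ne'
    · rw [sign_pos hc, sign_pos hd]

end Table

end OrderedStructures

/-! ### Extending a sign table by one polynomial. -/

namespace OrderedStructures

open Polynomial

section Insert

variable {K : Type*} [Field K] [LinearOrder K] [IsStrictOrderedRing K]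

/-- Both polynomials are strictly monotone, in the same direction, on the respective interval, and
have the same signs at the end points. -/
structure IsMatchedOn (f g : K[X]) (p q p' q' : K) : Prop where
  mono : (StrictMonoOn (fun x => f.eval x) (Set.Icc p q) ∧
      StrictMonoOn (fun x => g.eval x) (Set.Icc p' q')) ∨
    (StrictMonoOn (fun x => (-f).eval x) (Set.Icc p q) ∧
      StrictMonoOn (fun x => (-g).eval x) (Set.Icc p' q'))
  left : SignType.sign (f.eval p) = SignType.sign (g.eval p')
  right : SignType.sign (f.eval q) = SignType.sign (g.eval q')

theorem IsMatchedOn.symm {f g : K[X]} {p q p' q' : K} (h : IsMatchedOn f g p q p' q') :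
    IsMatchedOn g f p' q' p q where
  mono := h.mono.imp And.symm And.symm
  left := h.left.symm
  right := h.right.symm

theorem IsMatchedOn.root_transfer (hK : PolyIVT K) {f g : K[X]} {p q p' q' : K}
    (h : IsMatchedOn f g p q p' q') (hpq' : p' < q') {z : K} (h1 : p < z) (h2 : z < q)
    (hz : f.eval z = 0) : ∃ z', p' < z' ∧ z' < q' ∧ g.eval z' = 0 := by
  rcases h.mono with ⟨hf, -⟩ | ⟨hf, -⟩
  · exact hK.root_transfer hpq' hf h.left h.right h1 h2 hz
  · simpa using hK.root_transfer (g := -g) hpq' hf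
      (by simp [Left.sign_neg, h.left]) (by simp [Left.sign_neg, h.right]) h1 h2 (by simpa using hz)

theorem IsMatchedOn.sign_transfer (hK : PolyIVT K) {f g : K[X]} {p q p' q' : K}
    (h : IsMatchedOn f g p q p' q')
    {c d : K} (h1 : p < c) (h2 : c < q) (h1' : p' < d) (h2' : d < q')
    (hz : ∀ z z', (p < z ∧ z < q ∧ f.eval z = 0) → (p' < z' ∧ z' < q' ∧ g.eval z' = 0) →
      (z < c ↔ z' < d) ∧ (c < z ↔ d < z')) :
    SignType.sign (f.eval c) = SignType.sign (g.eval d) := by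
  rcases h.mono with ⟨hf, hg⟩ | ⟨hf, hg⟩
  · exact hK.sign_transfer hf hg h.left h.right h1 h2 h1' h2' hz
  · have := hK.sign_transfer hf hg (by simp [Left.sign_neg, h.left])
      (by simp [Left.sign_neg, h.right]) h1 h2 h1' h2' (by simpa using hz)
    simpa [Left.sign_neg] using this

variable {a b a' b' : K} {L : Finset (K × K)} {Q : Set (K[X] × K[X])}

theorem IsSignTable.samePosition (T : IsSignTable a b a' b' L Q) {u : K × K} (hu : u ∈ L) :
    SamePosition L u.1 u.2 := fun v hv => ⟨T.lt_iff v hv u hu, T.lt_iff u hu v hv⟩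

theorem IsSignTable.le_iff (T : IsSignTable a b a' b' L Q) {u v : K × K} (hu : u ∈ L)
    (hv : v ∈ L) : u.1 ≤ v.1 ↔ u.2 ≤ v.2 := by
  rw [← not_lt, ← not_lt, T.lt_iff v hv u hu]

/-- Neighbouring points of a sign table. -/
structure IsAdjacent (L : Finset (K × K)) (u w : K × K) : Prop where
  left_mem : u ∈ L
  right_mem : w ∈ L
  lt : u.1 < w.1
  le_or_le : ∀ v ∈ L, v.1 ≤ u.1 ∨ w.1 ≤ v.1

theorem IsSignTable.left_cases (T : IsSignTable a b a' b' L Q) {c : K} (h1 : a ≤ c) (h2 : c ≤ b) :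
    (∃ u ∈ L, u.1 = c) ∨ ∃ u w, IsAdjacent L u w ∧ u.1 < c ∧ c < w.1 := by
  refine (exists_eq_or_adjacent L Prod.fst T.left_mem T.right_mem h1 h2).imp id ?_
  rintro ⟨u, hu, w, hw, h3, h4, h5⟩
  exact ⟨u, w, ⟨hu, hw, h3.trans h4, h5⟩, h3, h4⟩

theorem IsSignTable.right_cases (T : IsSignTable a b a' b' L Q) {d : K} (h1 : a' ≤ d)
    (h2 : d ≤ b') :
    (∃ u ∈ L, u.2 = d) ∨ ∃ u w, IsAdjacent L u w ∧ u.2 < d ∧ d < w.2 := by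
  refine (exists_eq_or_adjacent L Prod.snd T.left_mem T.right_mem h1 h2).imp id ?_
  rintro ⟨u, hu, w, hw, h3, h4, h5⟩
  refine ⟨u, w, ⟨hu, hw, (T.lt_iff u hu w hw).2 (h3.trans h4), fun v hv => ?_⟩, h3, h4⟩
  exact (h5 v hv).imp (T.le_iff hv hu).2 (T.le_iff hw hv).2

theorem IsSignTable.samePosition_of_adjacent (T : IsSignTable a b a' b' L Q) {u w : K × K}
    (h : IsAdjacent L u w) {c d : K} (h1 : u.1 < c) (h2 : c < w.1) (h3 : u.2 < d) (h4 : d < w.2) :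
    SamePosition L c d := by
  intro v hv
  rcases h.le_or_le v hv with h' | h'
  · have h'' := (T.le_iff hv h.left_mem).1 h'
    exact ⟨iff_of_true (h'.trans_lt h1) (h''.trans_lt h3),
      iff_of_false (h'.trans h1.le).not_gt (h''.trans h3.le).not_gt⟩
  · have h'' := (T.le_iff h.right_mem hv).1 h'
    exact ⟨iff_of_false (h2.le.trans h').not_gt (h4.le.trans h'').not_gt,
      iff_of_true (h2.trans_le h') (h4.trans_le h'')⟩

/-- Between neighbouring table points the first derivative has no root, and every point on one side
has the same position as every point on the other. Comparing with one fixed point on the opposite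
side thus shows that both derivatives keep one common sign. -/
theorem IsSignTable.matchedOn (T : IsSignTable a b a' b' L Q) (hK : PolyIVT K) {P : K[X] × K[X]}
    (hP : (derivative P.1, derivative P.2) ∈ Q) (h1 : derivative P.1 ≠ 0)
    (hL : ∀ u ∈ L, SignType.sign (P.1.eval u.1) = SignType.sign (P.2.eval u.2))
    {u w : K × K} (h : IsAdjacent L u w) :
    IsMatchedOn P.1 P.2 u.1 w.1 u.2 w.2 := by
  refine ⟨?_, hL u h.left_mem, hL w h.right_mem⟩
  have hu := T.mem_Icc u h.left_mem
  have hw := T.mem_Icc w h.right_mem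
  have hlt := (T.lt_iff u h.left_mem w h.right_mem).1 h.lt
  have hsign : ∀ c d, u.1 < c → c < w.1 → u.2 < d → d < w.2 →
      SignType.sign ((derivative P.1).eval c) = SignType.sign ((derivative P.2).eval d) := by
    intro c d e1 e2 e3 e4
    exact T.sign_eq c d (hu.1.1.trans e1.le) (e2.le.trans hw.1.2) (hu.2.1.trans e3.le)
      (e4.le.trans hw.2.2) (T.samePosition_of_adjacent h e1 e2 e3 e4) _ hP
  have hne : ∀ c, u.1 < c → c < w.1 → (derivative P.1).eval c ≠ 0 := by
    intro c e1 e2 e0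
    obtain ⟨v, hv, rfl⟩ := T.roots_left _ hP h1 c (hu.1.1.trans e1.le) (e2.le.trans hw.1.2) e0
    exact (h.le_or_le v hv).elim (fun h' => h'.not_gt e1) (fun h' => h'.not_gt e2)
  obtain ⟨c₀, hc1, hc2⟩ := exists_between h.lt
  obtain ⟨d₀, hd1, hd2⟩ := exists_between hlt
  rcases lt_or_gt_of_ne (hne c₀ hc1 hc2) with h0 | h0
  · right
    have hd0 := hsign c₀ d₀ hc1 hc2 hd1 hd2
    rw [sign_neg h0] at hd0
    refine ⟨hK.strictMonoOn fun c e1 e2 => ?_, hK.strictMonoOn fun d e1 e2 => ?_⟩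
    · rw [derivative_neg, eval_neg, neg_pos]
      exact sign_eq_neg_one_iff.1 ((hsign c d₀ e1 e2 hd1 hd2).trans hd0.symm)
    · rw [derivative_neg, eval_neg, neg_pos]
      have := hsign c₀ d hc1 hc2 e1 e2
      rw [sign_neg h0] at this
      exact sign_eq_neg_one_iff.1 this.symm
  · left
    have hd0 := hsign c₀ d₀ hc1 hc2 hd1 hd2
    rw [sign_pos h0] at hd0
    refine ⟨hK.strictMonoOn fun c e1 e2 => ?_, hK.strictMonoOn fun d e1 e2 => ?_⟩
    · exact sign_eq_one_iff.1 ((hsign c d₀ e1 e2 hd1 hd2).trans hd0.symm)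
    · have := hsign c₀ d hc1 hc2 e1 e2
      rw [sign_pos h0] at this
      exact sign_eq_one_iff.1 this.symm

/-- With the derivative in the table, both polynomials are monotone between neighbours, so their
roots there are unique and occur in matching pairs. The last clause records where new points come
from, so that later signs at them can be found by division with remainder. -/
theorem IsSignTable.exists_insert (T : IsSignTable a b a' b' L Q) (hK : PolyIVT K)
    {P : K[X] × K[X]} (hP : (derivative P.1, derivative P.2) ∈ Q) (h1 : derivative P.1 ≠ 0)
    (h2 : derivative P.2 ≠ 0)
    (hL : ∀ u ∈ L, SignType.sign (P.1.eval u.1) = SignType.sign (P.2.eval u.2)) :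
    ∃ L', IsSignTable a b a' b' L' (insert P Q) ∧
      ∀ u ∈ L', u ∈ L ∨ (P.1.eval u.1 = 0 ∧ P.2.eval u.2 = 0) := by
  classical
  have hP1 : P.1 ≠ 0 := by rintro h0; simp [h0] at h1
  have hP2 : P.2 ≠ 0 := by rintro h0; simp [h0] at h2
  set N : Finset (K × K) := (P.1.roots.toFinset ×ˢ P.2.roots.toFinset).filter
    (fun z => (a ≤ z.1 ∧ z.1 ≤ b) ∧ (a' ≤ z.2 ∧ z.2 ≤ b') ∧ SamePosition L z.1 z.2) with hN
  have memN : ∀ z, z ∈ N ↔ (P.1.eval z.1 = 0 ∧ P.2.eval z.2 = 0) ∧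
      (a ≤ z.1 ∧ z.1 ≤ b) ∧ (a' ≤ z.2 ∧ z.2 ≤ b') ∧ SamePosition L z.1 z.2 := by
    intro z
    simp [hN, hP1, hP2]
  have newroot : ∀ {u w : K × K}, IsAdjacent L u w → ∀ z z', (u.1 < z ∧ z < w.1 ∧ P.1.eval z = 0) →
      (u.2 < z' ∧ z' < w.2 ∧ P.2.eval z' = 0) → (z, z') ∈ N := by
    intro u w h z z' hz hz'
    have hu := T.mem_Icc u h.left_mem
    have hw := T.mem_Icc w h.right_mem
    exact (memN _).2 ⟨⟨hz.2.2, hz'.2.2⟩, ⟨hu.1.1.trans hz.1.le, hz.2.1.le.trans hw.1.2⟩,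
      ⟨hu.2.1.trans hz'.1.le, hz'.2.1.le.trans hw.2.2⟩,
      T.samePosition_of_adjacent h hz.1 hz.2.1 hz'.1 hz'.2.1⟩
  refine ⟨L ∪ N, ?_, ?_⟩
  swap
  · intro u hu
    exact (Finset.mem_union.1 hu).imp id fun h => ((memN u).1 h).1
  constructor
  · exact Finset.mem_union_left _ T.left_mem
  · exact Finset.mem_union_left _ T.right_mem
  · intro u hu
    rcases Finset.mem_union.1 hu with hu | hu
    · exact T.mem_Icc u hu
    · exact ⟨((memN u).1 hu).2.1, ((memN u).1 hu).2.2.1⟩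
  · intro u hu v hv
    rcases Finset.mem_union.1 hu with hu | hu <;> rcases Finset.mem_union.1 hv with hv | hv
    · exact T.lt_iff u hu v hv
    · exact (((memN v).1 hv).2.2.2 u hu).1
    · exact (((memN u).1 hu).2.2.2 v hv).2
    · obtain ⟨⟨u1, u2⟩, u3, u4, u5⟩ := (memN u).1 hu
      obtain ⟨⟨v1, v2⟩, v3, v4, v5⟩ := (memN v).1 hv
      -- By Rolle a root of the derivative lies strictly between the two new roots. It is a table
      -- point, so it also separates the two matching roots, in the same order.
      constructor <;> intro hlt
      · obtain ⟨c, c1, c2, c3⟩ := hK.rolle hlt u1 v1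
        obtain ⟨x, hx, rfl⟩ := T.roots_left _ hP h1 c (u3.1.trans c1.le) (c2.le.trans v3.2) c3
        exact ((u5 x hx).2.1 c1).trans ((v5 x hx).1.1 c2)
      · obtain ⟨c, c1, c2, c3⟩ := hK.rolle hlt u2 v2
        obtain ⟨x, hx, rfl⟩ := T.roots_right _ hP h2 c (u4.1.trans c1.le) (c2.le.trans v4.2) c3
        exact ((u5 x hx).2.2 c1).trans ((v5 x hx).1.2 c2)
  · intro c d hc1 hc2 hd1 hd2 hcd
    have hcdL : SamePosition L c d := hcd.mono Finset.subset_union_left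
    rintro P' (rfl | hP')
    · rcases T.left_cases hc1 hc2 with ⟨u, hu, rfl⟩ | ⟨u, w, huw, h3, h4⟩
      · rw [← (hcdL.eq hu).1 rfl]
        exact hL u hu
      · refine (T.matchedOn hK hP h1 hL huw).sign_transfer hK h3 h4
          ((hcdL u huw.left_mem).1.1 h3) ((hcdL w huw.right_mem).2.1 h4) fun z z' hz hz' => ?_
        exact hcd (z, z') (Finset.mem_union_right _ (newroot huw z z' hz hz'))
    · exact T.sign_eq c d hc1 hc2 hd1 hd2 hcdL P' hP'
  · rintro P' (rfl | hP') h0 c hc1 hc2 hc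
    · rcases T.left_cases hc1 hc2 with ⟨u, hu, rfl⟩ | ⟨u, w, huw, h3, h4⟩
      · exact ⟨u, Finset.mem_union_left _ hu, rfl⟩
      · obtain ⟨d, hd⟩ := (T.matchedOn hK hP h1 hL huw).root_transfer hK
          ((T.lt_iff _ huw.left_mem _ huw.right_mem).1 huw.lt) h3 h4 hc
        exact ⟨(c, d), Finset.mem_union_right _ (newroot huw c d ⟨h3, h4, hc⟩ hd), rfl⟩
    · obtain ⟨u, hu, h⟩ := T.roots_left P' hP' h0 c hc1 hc2 hc
      exact ⟨u, Finset.mem_union_left _ hu, h⟩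
  · rintro P' (rfl | hP') h0 d hd1 hd2 hd
    · rcases T.right_cases hd1 hd2 with ⟨u, hu, rfl⟩ | ⟨u, w, huw, h3, h4⟩
      · exact ⟨u, Finset.mem_union_left _ hu, rfl⟩
      · obtain ⟨c, hc⟩ := (T.matchedOn hK hP h1 hL huw).symm.root_transfer hK huw.lt h3 h4 hd
        exact ⟨(c, d), Finset.mem_union_right _ (newroot huw c d hc ⟨h3, h4, hd⟩), rfl⟩
    · obtain ⟨u, hu, h⟩ := T.roots_right P' hP' h0 d hd1 hd2 hd
      exact ⟨u, Finset.mem_union_left _ hu, h⟩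

theorem IsSignTable.exists_samePosition (T : IsSignTable a b a' b' L Q) {c : K} (h1 : a ≤ c)
    (h2 : c ≤ b) : ∃ d, a' ≤ d ∧ d ≤ b' ∧ SamePosition L c d := by
  rcases T.left_cases h1 h2 with ⟨u, hu, rfl⟩ | ⟨u, w, h, h3, h4⟩
  · exact ⟨u.2, (T.mem_Icc u hu).2.1, (T.mem_Icc u hu).2.2, T.samePosition hu⟩
  · obtain ⟨d, hd1, hd2⟩ := exists_between ((T.lt_iff _ h.left_mem _ h.right_mem).1 h.lt)
    exact ⟨d, (T.mem_Icc u h.left_mem).2.1.trans hd1.le, hd2.le.trans (T.mem_Icc w h.right_mem).2.2,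
      T.samePosition_of_adjacent h h3 h4 hd1 hd2⟩

/-- Inserting a pair of constants of the same sign does not change the matched points. -/
theorem IsSignTable.insert_C (T : IsSignTable a b a' b' L Q) {x y : K}
    (hxy : SignType.sign x = SignType.sign y) : IsSignTable a b a' b' L (insert (C x, C y) Q) where
  left_mem := T.left_mem
  right_mem := T.right_mem
  mem_Icc := T.mem_Icc
  lt_iff := T.lt_iff
  sign_eq := by
    rintro c d hc1 hc2 hd1 hd2 h P (rfl | hP)
    · simpa using hxy
    · exact T.sign_eq c d hc1 hc2 hd1 hd2 h P hP
  roots_left := by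
    rintro P (rfl | hP) h0 c hc1 hc2 hc
    · simp only [eval_C] at hc
      simp [hc] at h0
    · exact T.roots_left P hP h0 c hc1 hc2 hc
  roots_right := by
    rintro P (rfl | hP) h0 c hc1 hc2 hc
    · simp only [eval_C] at hc
      simp [hc] at h0
    · exact T.roots_right P hP h0 c hc1 hc2 hc

theorem isSignTable_empty (h : a < b) (h' : a' < b') :
    IsSignTable a b a' b' {(a, a'), (b, b')} ∅ where
  left_mem := by simp
  right_mem := by simp
  mem_Icc := by simp [h.le, h'.le]
  lt_iff := by simp [h, h', h.not_gt, h'.not_gt]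
  sign_eq := by simp
  roots_left := by simp
  roots_right := by simp

end Insert

/-! ### Elimination of one variable. -/

section Projection

variable {K : Type*} [Field K] [LinearOrder K] [IsStrictOrderedRing K] {R : Type*} [CommRing R]

/-- A sign table for the images of the polynomials in `s`, all of whose inner points are
roots of polynomials in `s`. -/
def HasRootTable (φ ψ : R →+* K) (a b a' b' : K) (s : Set R[X]) : Prop :=
  ∃ L, IsSignTable a b a' b' L ((fun q : R[X] => (q.map φ, q.map ψ)) '' s) ∧
    ∀ u ∈ L, u = (a, a') ∨ u = (b, b') ∨ ∃ q ∈ s, 0 < q.natDegree ∧ φ q.leadingCoeff ≠ 0 ∧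
      (q.map φ).eval u.1 = 0 ∧ (q.map ψ).eval u.2 = 0

theorem sign_eq_zero_iff' {x y : K} (h : SignType.sign x = SignType.sign y) : x = 0 ↔ y = 0 := by
  rw [← sign_eq_zero_iff (a := x), h, sign_eq_zero_iff]

theorem map_eraseLead_of_leadingCoeff {φ : R →+* K} {p : R[X]} (h : φ p.leadingCoeff = 0) :
    p.eraseLead.map φ = p.map φ := by
  have := congrArg (Polynomial.map φ) (eraseLead_add_C_mul_X_pow p)
  simpa only [Polynomial.map_add, Polynomial.map_mul, map_C, h, C_0, zero_mul, add_zero] using this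

/-- Polynomials enter by increasing degree. If both leading coefficients specialize to zero, `p` has
the same images as its truncation, which is already present. Otherwise, at a table point that is a
root of `q`, a power of the leading coefficient of `q` times `p` equals the pseudo-remainder, whose
sign is known from its lower degree. This supplies the signs needed to insert `p`. -/
theorem hasRootTable_of_closed (hK : PolyIVT K) {φ ψ : R →+* K} {a b a' b' : K} (hab : a < b)
    (hab' : a' < b') (c : Finset R[X])
    (hd : ∀ p ∈ c, 0 < p.natDegree → derivative p ∈ c)
    (he : ∀ p ∈ c, 0 < p.natDegree → p.eraseLead ∈ c)
    (hr : ∀ p ∈ c, ∀ q ∈ c, 0 < p.natDegree → p.natDegree ≤ q.natDegree → pseudoRem p q ∈ c)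
    (hsign : ∀ p ∈ c, ∀ i, SignType.sign (φ (p.coeff i)) = SignType.sign (ψ (p.coeff i)))
    (hleft : ∀ p ∈ c, SignType.sign ((p.map φ).eval a) = SignType.sign ((p.map ψ).eval a'))
    (hright : ∀ p ∈ c, SignType.sign ((p.map φ).eval b) = SignType.sign ((p.map ψ).eval b'))
    (s : Finset R[X]) (hs : s ⊆ c) (hlow : ∀ p ∈ c, ∀ q ∈ s, p.natDegree < q.natDegree → p ∈ s) :
    HasRootTable φ ψ a b a' b' s := by
  classical
  induction s using Finset.induction_on_max_value (fun p : R[X] => p.natDegree) with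
  | empty => exact ⟨_, by simpa using isSignTable_empty hab hab', by simp⟩
  | insert p s hps hmax ih =>
    have hsc : s ⊆ c := (Finset.subset_insert _ _).trans hs
    have hpc : p ∈ c := hs (Finset.mem_insert_self _ _)
    have hlow' : ∀ q ∈ c, q.natDegree < p.natDegree → q ∈ s := by
      intro q hq hlt
      refine (Finset.mem_insert.1 (hlow q hq p (Finset.mem_insert_self _ _) hlt)).resolve_left ?_
      rintro rfl
      exact lt_irrefl _ hlt
    obtain ⟨L, T, hL⟩ := ih hsc fun q hq r hr hlt => hlow' q hq (hlt.trans_le (hmax r hr))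
    have himg : ((fun q : R[X] => (q.map φ, q.map ψ)) '' (insert p s : Finset R[X]) :
        Set (K[X] × K[X])) = insert (p.map φ, p.map ψ) ((fun q : R[X] => (q.map φ, q.map ψ)) '' s) := by
      rw [Finset.coe_insert, Set.image_insert_eq]
    have hL' : ∀ u ∈ L, u = (a, a') ∨ u = (b, b') ∨ ∃ q ∈ (insert p s : Finset R[X]),
        0 < q.natDegree ∧ φ q.leadingCoeff ≠ 0 ∧
        (q.map φ).eval u.1 = 0 ∧ (q.map ψ).eval u.2 = 0 := fun u hu =>
      (hL u hu).imp id (Or.imp id fun ⟨q, hq, h⟩ => ⟨q, Finset.mem_insert_of_mem hq, h⟩)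
    rcases Nat.eq_zero_or_pos p.natDegree with h0 | hpos
    · refine ⟨L, ?_, hL'⟩
      rw [himg, eq_C_of_natDegree_eq_zero h0, map_C, map_C]
      exact T.insert_C (hsign p hpc 0)
    by_cases hlc : φ p.leadingCoeff = 0
    · have hlc' : ψ p.leadingCoeff = 0 := (sign_eq_zero_iff' (hsign p hpc p.natDegree)).1 hlc
      refine ⟨L, ?_, hL'⟩
      rw [himg, Set.insert_eq_of_mem]
      · exact T
      · refine ⟨p.eraseLead, hlow' _ (he p hpc hpos) (natDegree_eraseLead_lt' hpos), ?_⟩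
        simp only [map_eraseLead_of_leadingCoeff hlc, map_eraseLead_of_leadingCoeff hlc']
    have hlc' : ψ p.leadingCoeff ≠ 0 :=
      fun h => hlc ((sign_eq_zero_iff' (hsign p hpc p.natDegree)).2 h)
    have hder : ∀ {χ : R →+* K}, χ p.leadingCoeff ≠ 0 → derivative (p.map χ) ≠ 0 := by
      intro χ h
      refine fun h' => hpos.ne' ?_
      rw [← natDegree_map_of_leadingCoeff_ne_zero χ h]
      exact derivative_eq_zero.1 h'
    have hpt : ∀ u ∈ L, SignType.sign ((p.map φ).eval u.1) = SignType.sign ((p.map ψ).eval u.2) := by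
      intro u hu
      rcases hL u hu with rfl | rfl | ⟨q, hq, hq0, hqlc, hqu, hqu'⟩
      · exact hleft p hpc
      · exact hright p hpc
      obtain ⟨k, t, hkt⟩ := pseudoRem_spec q p hq0
      have hrs : pseudoRem q p ∈ s := hlow' _ (hr q (hsc hq) p hpc hq0 (hmax q hq))
        ((natDegree_pseudoRem_lt q p hq0).trans_le (hmax q hq))
      have hu' := T.mem_Icc u hu
      have hsr := T.sign_eq u.1 u.2 hu'.1.1 hu'.1.2 hu'.2.1 hu'.2.2 (T.samePosition hu) _
        ⟨_, hrs, rfl⟩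
      have hqs := hsign q (hsc hq) q.natDegree
      rw [coeff_natDegree] at hqs
      have eval_eq : ∀ (χ : R →+* K) (z : K), (q.map χ).eval z = 0 →
          (χ q.leadingCoeff) ^ k * (p.map χ).eval z = ((pseudoRem q p).map χ).eval z := by
        intro χ z hz
        have := congrArg (fun f => (f.map χ).eval z) hkt
        simpa [hz] using this
      simp only at hsr
      rw [← eval_eq φ _ hqu, ← eval_eq ψ _ hqu', sign_mul, sign_mul, sign_pow, sign_pow, hqs] at hsr
      refine mul_left_cancel₀ ?_ hsr
      rw [← hqs]
      exact pow_ne_zero _ (by rwa [Ne, sign_eq_zero_iff])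
    obtain ⟨L', T', hL''⟩ := T.exists_insert hK (P := (p.map φ, p.map ψ))
      ⟨derivative p, hlow' _ (hd p hpc hpos) (natDegree_derivative_lt hpos.ne'), by
        simp [derivative_map]⟩ (hder hlc) (hder hlc') hpt
    refine ⟨L', by rw [himg]; exact T', fun u hu => ?_⟩
    rcases hL'' u hu with hu | hu
    · exact hL' u hu
    · exact Or.inr (Or.inr ⟨p, Finset.mem_insert_self _ _, hpos, hlc, hu⟩)

theorem natDegree_eq_of_sign_coeff_eq {f g : K[X]}
    (h : ∀ i, SignType.sign (f.coeff i) = SignType.sign (g.coeff i)) :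
    f.natDegree = g.natDegree := by
  have hs : f.support = g.support := by
    ext i
    rw [mem_support_iff, mem_support_iff, Ne, Ne, sign_eq_zero_iff' (h i)]
  refine natDegree_eq_of_degree_eq ?_
  rw [degree, degree, hs]

/-- This serves the end points of the tables: far out, signs are read off from the leading
coefficient and the parity of the degree. -/
theorem exists_bound_sign_eval (s : Finset K[X]) (M : K) :
    ∃ B, M < B ∧ ∀ f ∈ s, SignType.sign (f.eval B) = SignType.sign f.leadingCoeff ∧
      SignType.sign (f.eval (-B)) = SignType.sign ((-1) ^ f.natDegree * f.leadingCoeff) := by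
  have key : ∃ B, ∀ c, B ≤ c → M < c ∧
      ∀ f ∈ s, SignType.sign (f.eval c) = SignType.sign f.leadingCoeff ∧
        SignType.sign (f.eval (-c)) = SignType.sign ((-1) ^ f.natDegree * f.leadingCoeff) := by
    classical
    induction s using Finset.induction_on with
    | empty => exact ⟨M + 1, fun c hc => ⟨by linarith, by simp⟩⟩
    | insert f s _ ih =>
      obtain ⟨B, hB⟩ := ih
      obtain ⟨B₁, hB₁⟩ := eventually_sign_eval f
      obtain ⟨B₂, hB₂⟩ := eventually_sign_eval (f.comp (-X))
      refine ⟨max B (max B₁ B₂), fun c hc => ?_⟩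
      simp only [max_le_iff] at hc
      refine ⟨(hB c hc.1).1, fun g hg => ?_⟩
      rcases Finset.mem_insert.1 hg with rfl | hg
      · refine ⟨hB₁ c hc.2.1, ?_⟩
        have := hB₂ c hc.2.2
        rw [leadingCoeff_comp (by simp)] at this
        simpa [mul_comm] using this
      · exact (hB c hc.1).2 g hg
  obtain ⟨B, hB⟩ := key
  exact ⟨B, hB B le_rfl⟩

/-- Projection: whether a sign condition on finitely many polynomials in one variable is realized
depends only on the signs of finitely many elements of the coefficient ring. -/
theorem exists_finite_projection (hK : PolyIVT K) {S : Set R[X]} (hS : S.Finite) :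
    ∃ T : Set R, T.Finite ∧ ∀ φ ψ : R →+* K,
      (∀ t ∈ T, SignType.sign (φ t) = SignType.sign (ψ t)) → ∀ c, ∃ d, ∀ p ∈ S,
        SignType.sign ((p.map φ).eval c) = SignType.sign ((p.map ψ).eval d) := by
  classical
  have hfin := finite_remClosure hS
  set C : Finset R[X] := hfin.toFinset with hC
  have memC : ∀ p, p ∈ C ↔ RemClosure S p := by simp [hC]
  refine ⟨⋃ p ∈ C, (p.coeffs : Set R), C.finite_toSet.biUnion fun p _ => p.coeffs.finite_toSet,
    fun φ ψ h c => ?_⟩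
  have hsign : ∀ p ∈ C, ∀ i, SignType.sign (φ (p.coeff i)) = SignType.sign (ψ (p.coeff i)) := by
    intro p hp i
    by_cases h0 : p.coeff i = 0
    · simp [h0]
    · exact h _ (Set.mem_biUnion hp (coeff_mem_coeffs h0))
  -- The interval from `-B` to `B` contains `c`, and the signs at its ends depend only on
  -- coefficient signs, so they agree with those at `-B'` and `B'`.
  obtain ⟨B, hcB, hB⟩ := exists_bound_sign_eval (C.image (Polynomial.map φ)) |c|
  obtain ⟨B', hB'0, hB'⟩ := exists_bound_sign_eval (C.image (Polynomial.map ψ)) 0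
  have hB0 : 0 < B := (abs_nonneg c).trans_lt hcB
  have hends : ∀ p ∈ C, (p.map φ).natDegree = (p.map ψ).natDegree ∧
      SignType.sign (p.map φ).leadingCoeff = SignType.sign (p.map ψ).leadingCoeff := by
    intro p hp
    have hs : ∀ i, SignType.sign ((p.map φ).coeff i) = SignType.sign ((p.map ψ).coeff i) := by
      simpa using hsign p hp
    have hn := natDegree_eq_of_sign_coeff_eq hs
    exact ⟨hn, by rw [leadingCoeff, leadingCoeff, hn, hs]⟩
  obtain ⟨L, T, -⟩ := hasRootTable_of_closed hK (φ := φ) (ψ := ψ) (a := -B) (b := B) (a' := -B')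
    (b' := B') (by linarith) (by linarith) C
    (fun p hp h0 => (memC _).2 (((memC p).1 hp).deriv h0))
    (fun p hp h0 => (memC _).2 (((memC p).1 hp).erase h0))
    (fun p hp q hq h0 hpq => (memC _).2 (((memC p).1 hp).rem ((memC q).1 hq) h0 hpq))
    hsign
    (fun p hp => by
      rw [(hB _ (Finset.mem_image_of_mem _ hp)).2, (hB' _ (Finset.mem_image_of_mem _ hp)).2,
        (hends p hp).1, sign_mul, sign_mul, (hends p hp).2])
    (fun p hp => by
      rw [(hB _ (Finset.mem_image_of_mem _ hp)).1, (hB' _ (Finset.mem_image_of_mem _ hp)).1,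
        (hends p hp).2])
    C subset_rfl (fun p hp _ _ _ => hp)
  have hc := abs_lt.1 hcB
  obtain ⟨d, hd1, hd2, hd⟩ := T.exists_samePosition hc.1.le hc.2.le
  refine ⟨d, fun p hp => ?_⟩
  exact T.sign_eq c d hc.1.le hc.2.le hd1 hd2 hd _ ⟨p, (memC p).2 (.base hp), rfl⟩

end Projection

end OrderedStructures

/-! ### Quantifier elimination for formulas with parameters. -/

namespace OrderedStructures

open Polynomial FirstOrder

section Formulas

variable {K : Type*} [Field K] [LinearOrder K] [IsStrictOrderedRing K]

theorem exists_polynomial_of_term {A : Set K} {ι : Type*} (t : orderedRingLang[[A]].Term ι) :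
    ∃ P : MvPolynomial ι K, ∀ v : ι → K, MvPolynomial.eval v P = t.realize v := by
  induction t with
  | var i => exact ⟨MvPolynomial.X i, fun v => by simp⟩
  | @func l f ts ih =>
    choose P hP using ih
    rcases f with f | f
    · have key : ∀ v, (Language.Term.func (L := orderedRingLang[[A]]) (Sum.inl f) ts).realize v =
          Language.Structure.funMap (L := orderedRingLang) f
            (fun i => MvPolynomial.eval v (P i)) := by
        intro v
        simp only [hP, Language.Term.realize]
        rfl
      simp only [key]
      cases f with
      | add => exact ⟨P 0 + P 1, fun v => by rw [map_add]; rfl⟩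
      | mul => exact ⟨P 0 * P 1, fun v => by rw [map_mul]; rfl⟩
      | neg => exact ⟨-P 0, fun v => by rw [map_neg]; rfl⟩
      | zero => exact ⟨0, fun v => by rw [map_zero]; rfl⟩
      | one => exact ⟨1, fun v => by rw [map_one]; rfl⟩
    · rcases l with _ | l
      · refine ⟨MvPolynomial.C (Language.Structure.funMap (L := orderedRingLang[[A]])
          (Sum.inr f : orderedRingLang[[A]].Functions 0) default), fun v => ?_⟩
        rw [MvPolynomial.eval_C]
        exact congrArg _ (Subsingleton.elim _ _)
      · rcases l with _ | l <;> exact PEmpty.elim f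

/-- A multivariate polynomial as a univariate polynomial in its last bound variable. -/
noncomputable def lastVariable (α : Type*) (n : ℕ) (K : Type*) [Field K] :
    MvPolynomial (α ⊕ Fin (n + 1)) K →+* (MvPolynomial (α ⊕ Fin n) K)[X] :=
  MvPolynomial.eval₂Hom (Polynomial.C.comp MvPolynomial.C)
    (Sum.elim (fun i => C (MvPolynomial.X (Sum.inl i)))
      (Fin.snoc (fun j => C (MvPolynomial.X (Sum.inr j))) X))

theorem eval_lastVariable {α : Type*} {n : ℕ} (P : MvPolynomial (α ⊕ Fin (n + 1)) K) (v : α → K)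
    (xs : Fin n → K) (c : K) :
    ((lastVariable α n K P).map (MvPolynomial.eval (Sum.elim v xs))).eval c =
      MvPolynomial.eval (Sum.elim v (Fin.snoc xs c)) P := by
  induction P using MvPolynomial.induction_on with
  | C a => simp [lastVariable]
  | add p q hp hq => rw [map_add, Polynomial.map_add, eval_add, hp, hq, map_add]
  | mul_X p i hp =>
    rw [map_mul, Polynomial.map_mul, eval_mul, hp, map_mul]
    congr 1
    rcases i with i | i
    · simp [lastVariable]
    · refine Fin.lastCases ?_ (fun j => ?_) i <;> simp [lastVariable]

/-- The truth of a formula depends only on the signs of finitely many polynomials. -/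
theorem exists_finite_signs (hK : PolyIVT K) {A : Set K} {α : Type*} {n : ℕ}
    (φ : orderedRingLang[[A]].BoundedFormula α n) :
    ∃ S : Set (MvPolynomial (α ⊕ Fin n) K), S.Finite ∧ ∀ v xs v' xs',
      (∀ P ∈ S, SignType.sign (MvPolynomial.eval (Sum.elim v xs) P) =
        SignType.sign (MvPolynomial.eval (Sum.elim v' xs') P)) →
      (φ.Realize v xs ↔ φ.Realize v' xs') := by
  induction φ with
  | falsum => exact ⟨∅, Set.finite_empty, fun _ _ _ _ _ => Iff.rfl⟩
  | equal t₁ t₂ =>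
    obtain ⟨P, hP⟩ := exists_polynomial_of_term t₁
    obtain ⟨Q, hQ⟩ := exists_polynomial_of_term t₂
    refine ⟨{P - Q}, Set.finite_singleton _, fun v xs v' xs' h => ?_⟩
    have := sign_eq_zero_iff' (h _ rfl)
    rw [map_sub, map_sub, sub_eq_zero, sub_eq_zero, hP, hP, hQ, hQ] at this
    exact this
  | @rel n l R ts =>
    choose P hP using fun i => exists_polynomial_of_term (ts i)
    rcases R with R | R
    · cases R with
      | lt =>
        refine ⟨{P 1 - P 0}, Set.finite_singleton _, fun v xs v' xs' h => ?_⟩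
        have h2 := h _ rfl
        have h3 : 0 < MvPolynomial.eval (Sum.elim v xs) (P 1 - P 0) ↔
            0 < MvPolynomial.eval (Sum.elim v' xs') (P 1 - P 0) := by
          rw [← sign_eq_one_iff, h2, sign_eq_one_iff]
        rw [map_sub, map_sub, sub_pos, sub_pos, hP, hP, hP, hP] at h3
        exact h3
    · exact isEmptyElim (α := (Language.constantsOn A).Relations l) R
  | imp φ ψ ihφ ihψ =>
    obtain ⟨S, hS, h⟩ := ihφ
    obtain ⟨S', hS', h'⟩ := ihψ
    refine ⟨S ∪ S', hS.union hS', fun v xs v' xs' hs => ?_⟩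
    rw [Language.BoundedFormula.realize_imp, Language.BoundedFormula.realize_imp,
      h v xs v' xs' fun P hP => hs P (Or.inl hP), h' v xs v' xs' fun P hP => hs P (Or.inr hP)]
  | all φ ih =>
    obtain ⟨S, hS, h⟩ := ih
    -- The quantified variable becomes the polynomial variable over the ring of polynomials in the
    -- remaining ones; the two assignments are the two specializations of that ring.
    obtain ⟨T, hT, hproj⟩ := exists_finite_projection hK (hS.image (lastVariable α _ K))
    refine ⟨T, hT, ?_⟩
    have key : ∀ v xs v' xs',
        (∀ P ∈ T, SignType.sign (MvPolynomial.eval (Sum.elim v xs) P) =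
          SignType.sign (MvPolynomial.eval (Sum.elim v' xs') P)) →
        φ.all.Realize v xs → φ.all.Realize v' xs' := by
      intro v xs v' xs' hs hφ
      rw [Language.BoundedFormula.realize_all] at hφ ⊢
      intro c
      obtain ⟨d, hd⟩ := hproj _ _ (fun t ht => (hs t ht).symm) c
      refine (h v (Fin.snoc xs d) v' (Fin.snoc xs' c) fun P hP => ?_).1 (hφ d)
      rw [← eval_lastVariable, ← eval_lastVariable]
      exact (hd _ ⟨P, hP, rfl⟩).symm
    exact fun v xs v' xs' hs => ⟨key v xs v' xs' hs, key v' xs' v xs fun P hP => (hs P hP).symm⟩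

/-- The truth of a formula in one free variable depends only on the signs of finitely many
univariate polynomials. -/
theorem exists_finite_signs_formula (hK : PolyIVT K) {A : Set K}
    (φ : orderedRingLang[[A]].Formula (Fin 1)) :
    ∃ S : Set K[X], S.Finite ∧ ∀ x y,
      (∀ f ∈ S, SignType.sign (f.eval x) = SignType.sign (f.eval y)) →
      (φ.Realize (fun _ => x) ↔ φ.Realize (fun _ => y)) := by
  obtain ⟨S, hS, h⟩ := exists_finite_signs hK φ
  refine ⟨_, hS.image (MvPolynomial.aeval fun _ => (X : K[X])), fun x y hxy => ?_⟩
  have key : ∀ (P : MvPolynomial (Fin 1 ⊕ Fin 0) K) (x : K) (xs : Fin 0 → K),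
      (MvPolynomial.aeval (fun _ => (X : K[X])) P).eval x =
        MvPolynomial.eval (Sum.elim (fun _ => x) xs) P := by
    intro P x xs
    induction P using MvPolynomial.induction_on with
    | C a => simp
    | add p q hp hq => rw [map_add, eval_add, hp, hq, map_add]
    | mul_X p i hp =>
      rw [map_mul, eval_mul, hp, map_mul]
      rcases i with i | i
      · simp
      · exact i.elim0
  refine h (fun _ => x) default (fun _ => y) default fun P hP => ?_
  rw [← key, ← key]
  exact hxy _ ⟨P, hP, rfl⟩

end Formulas

/-! ### Saturation from separation of countable sets. -/

/-- Between any two countable sets, one below the other, there is an element. -/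
def CountableCutProperty (M : Type*) [LT M] : Prop :=
  ∀ A B : Set M, A.Countable → B.Countable → (∀ a ∈ A, ∀ b ∈ B, a < b) →
    ∃ x, (∀ a ∈ A, a < x) ∧ ∀ b ∈ B, x < b

instance : Countable (Σ l, orderedRingLang.Functions l) := by
  refine Function.Injective.countable (β := ℕ) (f := fun s => match s with
    | ⟨_, .add⟩ => 0 | ⟨_, .mul⟩ => 1 | ⟨_, .neg⟩ => 2 | ⟨_, .zero⟩ => 3 | ⟨_, .one⟩ => 4) ?_
  rintro ⟨_, a⟩ ⟨_, b⟩ h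
  cases a <;> cases b <;> first | rfl | simp at h

instance : Countable (Σ l, orderedRingLang.Relations l) := by
  refine Function.Injective.countable (β := ℕ) (f := fun _ => 0) ?_
  rintro ⟨_, a⟩ ⟨_, b⟩ h
  cases a; cases b; rfl

instance : Countable orderedRingLang.Symbols :=
  inferInstanceAs (Countable ((Σ l, orderedRingLang.Functions l) ⊕ Σ l, orderedRingLang.Relations l))

theorem countable_of_mk_lt_aleph_one {M : Type*} {A : Set M}
    (hA : Cardinal.mk A < Cardinal.aleph 1) : A.Countable := by
  rw [← Cardinal.le_aleph0_iff_set_countable]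
  rwa [← Order.lt_succ_iff, Cardinal.succ_aleph0]

/-- An ultrafilter containing all the sets defined by a finitely satisfiable set of formulas. -/
theorem exists_ultrafilter_of_finitely_satisfiable {L : Language} {M : Type*} [L.Structure M]
    {p : Set (L.Formula (Fin 1))}
    (hp : ∀ s : Finset (L.Formula (Fin 1)), (s : Set (L.Formula (Fin 1))) ⊆ p →
      ∃ x : M, ∀ φ ∈ s, φ.Realize (fun _ => x)) :
    ∃ U : Ultrafilter M, ∀ φ ∈ p, {x | φ.Realize fun _ => x} ∈ U := by
  classical
  set D : L.Formula (Fin 1) → Set M := fun φ => {x | φ.Realize fun _ => x} with hD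
  have hne : (Filter.generate (D '' p)).NeBot := by
    rw [Filter.generate_neBot_iff]
    intro t ht hfin
    lift t to Finset (Set M) using hfin
    obtain ⟨s, hs, rfl⟩ := Finset.subset_set_image_iff.1 ht
    obtain ⟨x, hx⟩ := hp s hs
    refine ⟨x, ?_⟩
    rw [Finset.coe_image]
    rintro _ ⟨φ, hφ, rfl⟩
    exact hx φ hφ
  refine ⟨Ultrafilter.of (Filter.generate (D '' p)), fun φ hφ => Ultrafilter.of_le _ ?_⟩
  exact Filter.mem_generate_of_mem ⟨φ, hφ, rfl⟩

/-- An ultrafilter containing the type decides on which side of each relevant root to lie. If it is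
principal, its point realizes the type; otherwise an element of the resulting countable cut does. -/
theorem isSaturated_of_countableCutProperty {K : Type*} [Field K] [LinearOrder K]
    [IsStrictOrderedRing K] (hK : PolyIVT K) (hcut : CountableCutProperty K) :
    IsSaturated (Cardinal.aleph 1) orderedRingLang K := by
  intro A hA p hp
  have hAc : Countable A := (countable_of_mk_lt_aleph_one hA).to_subtype
  obtain ⟨U, hU⟩ := exists_ultrafilter_of_finitely_satisfiable hp
  choose S hS hSφ using fun φ : orderedRingLang[[A]].Formula (Fin 1) =>
    exists_finite_signs_formula hK φ
  set Z : orderedRingLang[[A]].Formula (Fin 1) → Set K :=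
    fun φ => ⋃ f ∈ S φ, {r | f ≠ 0 ∧ f.eval r = 0} with hZ
  have hZfin : ∀ φ, (Z φ).Finite := by
    refine fun φ => (hS φ).biUnion fun f _ => ?_
    by_cases h0 : f = 0
    · simp [h0]
    · refine (f.roots.toFinset.finite_toSet).subset ?_
      rintro r ⟨-, hr⟩
      simp [h0, hr]
  -- The language and the parameter set are countable, so there are only countably many formulas.
  have hZc : (⋃ φ, Z φ).Countable := Set.countable_iUnion fun φ => (hZfin φ).countable
  by_cases hprinc : ∃ r, {r} ∈ U
  · obtain ⟨r, hr⟩ := hprinc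
    refine ⟨r, fun φ hφ => ?_⟩
    obtain ⟨y, hy, rfl⟩ := U.nonempty_of_mem (Filter.inter_mem (hU φ hφ) hr)
    exact hy
  push Not at hprinc
  have htri : ∀ r, Set.Ioi r ∈ U ∨ Set.Iio r ∈ U := by
    intro r
    have h1 := Ultrafilter.compl_mem_iff_notMem.2 (hprinc r)
    rw [← Set.Iio_union_Ioi, Ultrafilter.union_mem_iff] at h1
    exact h1.symm
  obtain ⟨x, hx1, hx2⟩ := hcut {r ∈ ⋃ φ, Z φ | Set.Ioi r ∈ U} {r ∈ ⋃ φ, Z φ | Set.Iio r ∈ U}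
    (hZc.mono fun _ h => h.1) (hZc.mono fun _ h => h.1) (by
      rintro a ⟨-, ha⟩ b ⟨-, hb⟩
      obtain ⟨y, hy1, hy2⟩ := U.nonempty_of_mem (Filter.inter_mem ha hb)
      exact lt_trans hy1 hy2)
  refine ⟨x, fun φ hφ => ?_⟩
  have hside : ∀ r ∈ Z φ, {y | (r < y ∧ r < x) ∨ (y < r ∧ x < r)} ∈ U := by
    intro r hr
    have hr' : r ∈ ⋃ φ, Z φ := Set.mem_iUnion_of_mem φ hr
    rcases htri r with h | h
    · exact Filter.mem_of_superset h fun y hy => Or.inl ⟨hy, hx1 r ⟨hr', h⟩⟩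
    · exact Filter.mem_of_superset h fun y hy => Or.inr ⟨hy, hx2 r ⟨hr', h⟩⟩
  -- Only finitely many roots matter for `φ`, so some `y` satisfying `φ` lies on the same side as
  -- `x` of all of them. No relevant root separates `x` from `y`, and the signs agree.
  obtain ⟨y, hy, hy'⟩ := U.nonempty_of_mem
    (Filter.inter_mem (hU φ hφ) ((Filter.biInter_mem (hZfin φ)).2 hside))
  refine (hSφ φ x y fun f hf => ?_).2 hy
  by_cases h0 : f = 0
  · simp [h0]
  have hroot : ∀ r, f.eval r = 0 → (r < y ∧ r < x) ∨ (y < r ∧ x < r) := fun r hr =>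
    Set.mem_iInter₂.1 hy' r (Set.mem_biUnion hf ⟨h0, hr⟩)
  rcases le_total x y with hxy | hxy
  · refine hK.sign_eq_of_no_root hxy fun c h1 h2 hc => ?_
    rcases hroot c hc with h | h
    · exact h.2.not_ge h1
    · exact h.1.not_ge h2
  · refine (hK.sign_eq_of_no_root hxy fun c h1 h2 hc => ?_).symm
    rcases hroot c hc with h | h
    · exact h.1.not_ge h1
    · exact h.2.not_ge h2

end OrderedStructures

/-! ### Valuations, centers of cuts and separation in Hahn series fields. -/

namespace OrderedStructures

section Hahn

variable {G : Type*} [AddCommGroup G] [LinearOrder G] [IsOrderedAddMonoid G]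

/-- The valuation of a Hahn series: the least element of the support. -/
noncomputable def val (x : Lex (HahnSeries G ℝ)) : WithTop G := (ofLex x).orderTop

/-- The monomial `r t ^ γ`. -/
noncomputable def mono (γ : G) (r : ℝ) : Lex (HahnSeries G ℝ) := toLex (HahnSeries.single γ r)

theorem val_neg (x : Lex (HahnSeries G ℝ)) : val (-x) = val x := HahnSeries.orderTop_neg

theorem val_sub_comm (x y : Lex (HahnSeries G ℝ)) : val (x - y) = val (y - x) := by
  rw [← val_neg, neg_sub]

theorem lt_val_add {γ : WithTop G} {x y : Lex (HahnSeries G ℝ)} (hx : γ < val x) (hy : γ < val y) :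
    γ < val (x + y) :=
  (lt_min hx hy).trans_le HahnSeries.min_orderTop_le_orderTop_add

theorem lt_val_sub {γ : WithTop G} {x y : Lex (HahnSeries G ℝ)} (hx : γ < val x) (hy : γ < val y) :
    γ < val (x - y) :=
  (lt_min hx hy).trans_le HahnSeries.min_orderTop_le_orderTop_sub

theorem val_mul (x y : Lex (HahnSeries G ℝ)) : val (x * y) = val x + val y :=
  HahnSeries.orderTop_mul _ _

theorem val_eq_top {x : Lex (HahnSeries G ℝ)} : val x = ⊤ ↔ x = 0 := HahnSeries.orderTop_eq_top

theorem val_anti {x y : Lex (HahnSeries G ℝ)} (hx : 0 ≤ x) (hxy : x ≤ y) : val y ≤ val x := by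
  by_contra! h
  have := HahnSeries.abs_lt_abs_of_orderTop_ofLex h
  rw [abs_of_nonneg hx, abs_of_nonneg (hx.trans hxy)] at this
  exact this.not_ge hxy

theorem lt_of_val_lt {x y : Lex (HahnSeries G ℝ)} (hy : 0 < y) (h : val y < val x) : x < y := by
  have := HahnSeries.abs_lt_abs_of_orderTop_ofLex h
  rw [abs_of_pos hy] at this
  exact (le_abs_self x).trans_lt this

theorem lt_val_iff {γ : G} {x : Lex (HahnSeries G ℝ)} :
    (γ : WithTop G) < val x ↔ ∀ j ≤ γ, (ofLex x).coeff j = 0 := by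
  refine ⟨fun h j hj => HahnSeries.coeff_eq_zero_of_lt_orderTop
    ((WithTop.coe_le_coe.2 hj).trans_lt h), fun h => ?_⟩
  by_contra! h'
  obtain ⟨δ, hδ⟩ := WithTop.ne_top_iff_exists.1 (h'.trans_lt (WithTop.coe_lt_top γ)).ne
  rw [← hδ, WithTop.coe_le_coe] at h'
  exact HahnSeries.coeff_orderTop_ne hδ.symm (h δ h')

theorem val_mono (γ : G) {r : ℝ} (hr : r ≠ 0) : val (mono γ r) = γ := HahnSeries.orderTop_single hr

theorem mono_pos (γ : G) {r : ℝ} (hr : 0 < r) : 0 < mono γ r :=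
  (HahnSeries.lt_iff _ _).2 ⟨γ, fun j hj => by simp [mono, HahnSeries.coeff_single_of_ne hj.ne],
    by simpa [mono] using hr⟩

theorem mono_add (γ : G) (r s : ℝ) : mono γ (r + s) = mono γ r + mono γ s :=
  HahnSeries.single_add γ r s

theorem mono_neg (γ : G) (r : ℝ) : mono γ (-r) = -mono γ r := HahnSeries.single_neg γ r

theorem mono_zero (γ : G) : mono γ 0 = 0 := HahnSeries.single_eq_zero

theorem mono_lt_mono {γ : G} {r s : ℝ} (h : r < s) : mono γ r < mono γ s := by
  have := mono_pos γ (sub_pos.2 h)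
  rw [sub_eq_add_neg, mono_add, mono_neg] at this
  linarith

theorem exists_lt_mono {γ : G} {y : Lex (HahnSeries G ℝ)} (h : (γ : WithTop G) ≤ val y) :
    ∃ r > 0, y < mono γ r := by
  refine ⟨|(ofLex y).coeff γ| + 1, by positivity, (HahnSeries.lt_iff _ _).2 ⟨γ, fun j hj => ?_, ?_⟩⟩
  · rw [HahnSeries.coeff_eq_zero_of_lt_orderTop ((WithTop.coe_lt_coe.2 hj).trans_le h)]
    simp [mono, HahnSeries.coeff_single_of_ne hj.ne]
  · simpa [mono] using lt_of_le_of_lt (le_abs_self _) (lt_add_one _)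

/-- Valuations of real Hahn series are exactly the archimedean classes, which lets integer multiples
replace coefficient computations. -/
theorem val_le_val_iff {x y : Lex (HahnSeries G ℝ)} :
    val y ≤ val x ↔ ∃ n : ℕ, |x| ≤ n * |y| := by
  have h : ∀ z : Lex (HahnSeries G ℝ),
      HahnSeries.archimedeanClassOrderIsoWithTop G ℝ (ArchimedeanClass.mk z) = val z :=
    HahnSeries.archimedeanClassOrderIsoWithTop_apply
  rw [← h, ← h, OrderIso.le_iff_le, ArchimedeanClass.mk_le_mk]
  simp only [nsmul_eq_mul]

theorem exists_nat_mul_lt {x y : Lex (HahnSeries G ℝ)} (hy : 0 < y) (h : val y ≤ val x) :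
    ∃ n : ℕ, 0 < n ∧ x < n * y := by
  obtain ⟨n, hn⟩ := val_le_val_iff.1 h
  refine ⟨n + 1, by omega, ?_⟩
  rw [abs_of_pos hy] at hn
  push_cast
  have := le_abs_self x
  linarith

theorem exists_mono_lt {γ : G} {y : Lex (HahnSeries G ℝ)} (hy : 0 < y)
    (h : val y ≤ (γ : WithTop G)) : ∃ r > 0, mono γ r < y := by
  obtain ⟨n, hn, h1⟩ := exists_nat_mul_lt (x := mono γ 1) hy (by rwa [val_mono _ one_ne_zero])
  have hn' : (0 : ℝ) < n := by exact_mod_cast hn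
  refine ⟨1 / n, by positivity, ?_⟩
  have h2 : ∀ m : ℕ, ∀ r : ℝ, mono γ (m * r) = (m : Lex (HahnSeries G ℝ)) * mono γ r := by
    intro m r
    induction m with
    | zero => simp [mono_zero]
    | succ m ih => push_cast; rw [add_mul, mono_add, ih, one_mul, add_mul, one_mul]
  have h3 := h2 n (1 / n)
  rw [mul_one_div_cancel hn'.ne'] at h3
  rw [h3] at h1
  exact lt_of_mul_lt_mul_left h1 (Nat.cast_nonneg n)

theorem val_natCast_mul {n : ℕ} (hn : 0 < n) (x : Lex (HahnSeries G ℝ)) :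
    val ((n : Lex (HahnSeries G ℝ)) * x) = val x := by
  have hn' : (1 : Lex (HahnSeries G ℝ)) ≤ n := by exact_mod_cast hn
  refine le_antisymm (val_le_val_iff.2 ⟨1, ?_⟩) (val_le_val_iff.2 ⟨n, ?_⟩)
  · rw [abs_mul, Nat.abs_cast, Nat.cast_one, one_mul]
    exact le_mul_of_one_le_left (abs_nonneg x) hn'
  · rw [abs_mul, Nat.abs_cast]

/-- A center of a lower set `L` of the field: an element such that, on the side of the center that
meets the cut, membership depends only on the valuation of the difference. -/
theorem exists_center {L : Set (Lex (HahnSeries G ℝ))} (hL : IsLowerSet L) :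
    ∃ x, (x ∈ L ∧ ∀ y z, 0 < y → 0 < z → val y = val z → x + y ∈ L → x + z ∈ L) ∨
      (x ∉ L ∧ ∀ y z, 0 < y → 0 < z → val y = val z → x - y ∉ L → x - z ∉ L) := by
  classical
  have lt_of_mem : ∀ {a b}, a ∈ L → b ∉ L → a < b := fun ha hb =>
    not_le.1 fun h => hb (hL h ha)
  -- These are the exponents up to which some pair of points across the cut agrees. All lower points
  -- of such pairs then share their coefficients up to that exponent.
  set Γ₀ : Set G := {γ | ∃ p : Lex (HahnSeries G ℝ) × Lex (HahnSeries G ℝ),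
    p.1 ∈ L ∧ p.2 ∉ L ∧ (γ : WithTop G) < val (p.2 - p.1)} with hΓ
  choose! P hPL hPU hP using (fun γ (h : γ ∈ Γ₀) => h)
  have hdown : ∀ {γ δ : G}, δ ≤ γ → γ ∈ Γ₀ → δ ∈ Γ₀ := fun hδ ⟨p, h1, h2, h3⟩ =>
    ⟨p, h1, h2, (WithTop.coe_le_coe.2 hδ).trans_lt h3⟩
  have hclose : ∀ {γ : G} {a b a' b' : Lex (HahnSeries G ℝ)}, a ∈ L → b ∉ L → a' ∈ L → b' ∉ L →
      (γ : WithTop G) < val (b - a) → (γ : WithTop G) < val (b' - a') →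
      (γ : WithTop G) < val (a' - a) := by
    intro γ a b a' b' ha hb ha' hb' h h'
    rcases le_total a a' with hle | hle
    · exact h.trans_le (val_anti (sub_nonneg.2 hle) (sub_le_sub_right (lt_of_mem ha' hb).le _))
    · rw [val_sub_comm]
      exact h'.trans_le (val_anti (sub_nonneg.2 hle) (sub_le_sub_right (lt_of_mem ha hb').le _))
  have hcoh : ∀ {γ δ : G}, δ ≤ γ → γ ∈ Γ₀ →
      (ofLex (P δ).1).coeff δ = (ofLex (P γ).1).coeff δ := by
    intro γ δ hδ hγ
    have hδ' := hdown hδ hγ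
    have := lt_val_iff.1 (hclose (hPL γ hγ) (hPU γ hγ) (hPL δ hδ') (hPU δ hδ')
      ((WithTop.coe_le_coe.2 hδ).trans_lt (hP γ hγ)) (hP δ hδ')) δ le_rfl
    exact sub_eq_zero.1 this
  set c : G → ℝ := fun γ => if γ ∈ Γ₀ then (ofLex (P γ).1).coeff γ else 0 with hc
  have hsupp : (Function.support c).IsPWO := by
    rw [Set.isPWO_iff_isWF, Set.isWF_iff_no_descending_seq]
    intro f hf hmem
    have h0 : f 0 ∈ Γ₀ := by
      by_contra h
      exact hmem 0 (by simp [hc, h])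
    -- A descending sequence in the glued support stays below its first term, hence inside the
    -- support of a single approximation.
    refine Set.isWF_iff_no_descending_seq.1 (ofLex (P (f 0)).1).isWF_support f hf fun n => ?_
    have h1 := hmem n
    have h2 : f n ≤ f 0 := hf.antitone (Nat.zero_le n)
    simp only [hc, Function.mem_support, if_pos (hdown h2 h0), hcoh h2 h0] at h1
    exact h1
  set x : Lex (HahnSeries G ℝ) := toLex ⟨c, hsupp⟩ with hx
  have hxa : ∀ {γ : G} {a b}, a ∈ L → b ∉ L → (γ : WithTop G) < val (b - a) →
      (γ : WithTop G) < val (x - a) := by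
    intro γ a b ha hb h
    have hγ : γ ∈ Γ₀ := ⟨(a, b), ha, hb, h⟩
    have h1 : (γ : WithTop G) < val (x - (P γ).1) := by
      refine lt_val_iff.2 fun j hj => ?_
      refine sub_eq_zero.2 ?_
      show c j = (ofLex (P γ).1).coeff j
      simp only [hc, if_pos (hdown hj hγ), hcoh hj hγ]
    have h2 := hclose ha hb (hPL γ hγ) (hPU γ hγ) h (hP γ hγ)
    simpa using lt_val_add h1 h2
  by_contra! hcon
  -- If `x` is not a center, the cut passes between two real multiples of one monomial added to `x`,
  -- at an exponent too large for the cut to be that narrow. The supremum of the multiples in `L`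
  -- then corrects `x` to a center.
  obtain ⟨γ, hγ, r₀, r₁, hr₀, hr₁⟩ : ∃ γ : G, γ ∉ Γ₀ ∧ ∃ r₀ r₁ : ℝ,
      x + mono γ r₀ ∈ L ∧ x + mono γ r₁ ∉ L := by
    by_cases hxL : x ∈ L
    · obtain ⟨y, z, hy, hz, hyz, h1, h2⟩ := (hcon x).1 hxL
      obtain ⟨γ, hγ⟩ := WithTop.ne_top_iff_exists.1 (mt val_eq_top.1 hy.ne')
      obtain ⟨r, -, hr⟩ := exists_lt_mono (hγ.trans hyz).le
      refine ⟨γ, ?_, 0, r, by simpa [mono_zero] using hxL,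
        fun h => h2 (hL (by gcongr) h)⟩
      rintro ⟨⟨a, b⟩, ha, hb, hab⟩
      have h3 : (γ : WithTop G) < val (b - x) := by
        have := lt_val_sub hab (hxa ha hb hab)
        simpa using this
      have := lt_of_val_lt hy (hγ ▸ h3)
      exact hb (hL (by linarith) h1)
    · obtain ⟨y, z, hy, hz, hyz, h1, h2⟩ := (hcon x).2 hxL
      obtain ⟨γ, hγ⟩ := WithTop.ne_top_iff_exists.1 (mt val_eq_top.1 hy.ne')
      obtain ⟨r, -, hr⟩ := exists_lt_mono (hγ.trans hyz).le
      refine ⟨γ, ?_, -r, 0, hL (?_ : _ ≤ x - z) h2, by simpa [mono_zero] using hxL⟩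
      swap
      · rw [mono_neg]; linarith
      rintro ⟨⟨a, b⟩, ha, hb, hab⟩
      have := lt_of_val_lt hy (hγ ▸ hxa ha hb hab)
      exact h1 (hL (by linarith) ha)
  set D : Set ℝ := {r | x + mono γ r ∈ L} with hD
  have hDbdd : BddAbove D := ⟨r₁, fun r hr => le_of_not_gt fun h =>
    hr₁ (hL (by have := mono_lt_mono (γ := γ) h; linarith) hr)⟩
  set s := sSup D with hs
  have hlt : ∀ r < s, x + mono γ r ∈ L := by
    intro r hr
    obtain ⟨r', hr', h⟩ := exists_lt_of_lt_csSup ⟨r₀, hr₀⟩ hr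
    exact hL (by have := mono_lt_mono (γ := γ) h; linarith) hr'
  have hgt : ∀ r, s < r → x + mono γ r ∉ L := fun r hr h => (le_csSup hDbdd h).not_gt hr
  have hle_of_val : ∀ {y : Lex (HahnSeries G ℝ)}, 0 < y → val y ≤ (γ : WithTop G) →
      x + mono γ s + y ∉ L ∧ x + mono γ s - y ∈ L := by
    intro y hy h
    obtain ⟨r, hr, hry⟩ := exists_mono_lt hy h
    constructor
    · refine fun h' => hgt (s + r) (by linarith) (hL ?_ h')
      rw [mono_add]; linarith
    · refine hL ?_ (hlt (s - r) (by linarith))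
      rw [sub_eq_add_neg s r, mono_add, mono_neg]; linarith
  have hsmall : ∀ {a b : Lex (HahnSeries G ℝ)}, a ∈ L → b ∉ L →
      ¬ (γ : WithTop G) < val (b - a) := fun ha hb h => hγ ⟨(_, _), ha, hb, h⟩
  by_cases hsL : x + mono γ s ∈ L
  · obtain ⟨y, z, hy, hz, hyz, h1, h2⟩ := (hcon _).1 hsL
    refine hsmall hsL h2 ?_
    rw [add_sub_cancel_left, ← hyz]
    by_contra! h
    exact (hle_of_val hy h).1 h1
  · obtain ⟨y, z, hy, hz, hyz, h1, h2⟩ := (hcon _).2 hsL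
    refine hsmall h2 hsL ?_
    rw [sub_sub_cancel, ← hyz]
    by_contra! h
    exact h1 (hle_of_val hy h).2

/-- Take a center of the lower set generated by `A`. Elements of `A` and `B` beyond it, on the side
of the cut, cannot be at distances of equal valuation, so separating countable sets of valuations in
`G` is enough. Larger positive elements have smaller valuations, hence the reversed roles in `key`.
-/
theorem countableCutProperty_hahn (hG : CountableCutProperty G) :
    CountableCutProperty (Lex (HahnSeries G ℝ)) := by
  intro A B hA hB hAB
  have hcount : ∀ {S : Set (Lex (HahnSeries G ℝ))}, S.Countable →
      {γ : G | ∃ s ∈ S, val s = γ}.Countable := by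
    intro S hS
    refine ((hS.image val).preimage WithTop.coe_injective).mono ?_
    rintro γ ⟨s, hs, h⟩
    exact ⟨s, hs, h⟩
  have hlift : ∀ {x : Lex (HahnSeries G ℝ)}, 0 < x → ∃ γ : G, val x = γ := fun hx => by
    obtain ⟨γ, hγ⟩ := WithTop.ne_top_iff_exists.1 (mt val_eq_top.1 hx.ne')
    exact ⟨γ, hγ.symm⟩
  -- an element separated in valuation from two sets of positive elements
  have key : ∀ {S T : Set (Lex (HahnSeries G ℝ))}, S.Countable → T.Countable →
      (∀ s ∈ S, ∀ t ∈ T, 0 < s → 0 < t → s < t ∧ val s ≠ val t) →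
      ∃ w, 0 < w ∧ (∀ s ∈ S, s < w) ∧ ∀ t ∈ T, 0 < t → w < t := by
    intro S T hS hT h
    obtain ⟨γ, h1, h2⟩ := hG {γ : G | ∃ t ∈ T ∩ Set.Ioi 0, val t = γ}
      {γ : G | ∃ s ∈ S ∩ Set.Ioi 0, val s = γ}
      (hcount (hT.mono Set.inter_subset_left)) (hcount (hS.mono Set.inter_subset_left)) (by
        rintro γ ⟨t, ⟨ht, ht0⟩, hγ⟩ δ ⟨s, ⟨hs, hs0⟩, hδ⟩
        obtain ⟨h3, h4⟩ := h s hs t ht hs0 ht0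
        rw [← WithTop.coe_lt_coe, ← hγ, ← hδ]
        exact lt_of_le_of_ne (val_anti (le_of_lt hs0) h3.le) (Ne.symm h4))
    have hw := val_mono γ one_ne_zero
    refine ⟨mono γ 1, mono_pos γ one_pos, fun s hs => ?_, fun t ht ht0 => ?_⟩
    · rcases le_or_gt s 0 with hs0 | hs0
      · exact hs0.trans_lt (mono_pos γ one_pos)
      · obtain ⟨δ, hδ⟩ := hlift hs0
        refine lt_of_val_lt (mono_pos γ one_pos) ?_
        rw [hw, hδ, WithTop.coe_lt_coe]
        exact h2 δ ⟨s, ⟨hs, hs0⟩, hδ⟩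
    · obtain ⟨δ, hδ⟩ := hlift ht0
      refine lt_of_val_lt ht0 ?_
      rw [hw, hδ, WithTop.coe_lt_coe]
      exact h1 δ ⟨t, ⟨ht, ht0⟩, hδ⟩
  set L : Set (Lex (HahnSeries G ℝ)) := {y | ∃ a ∈ A, y ≤ a} with hLdef
  have hL : IsLowerSet L := fun y z hzy ⟨a, ha, h⟩ => ⟨a, ha, hzy.trans h⟩
  have hAL : ∀ a ∈ A, a ∈ L := fun a ha => ⟨a, ha, le_rfl⟩
  have hBL : ∀ b ∈ B, b ∉ L := fun b hb ⟨a, ha, h⟩ => (hAB a ha b hb).not_ge h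
  obtain ⟨x, ⟨hx, hc⟩ | ⟨hx, hc⟩⟩ := exists_center hL
  · obtain ⟨w, hw0, h1, h2⟩ := key (hA.image fun a => a - x) (hB.image fun b => b - x) (by
      rintro _ ⟨a, ha, rfl⟩ _ ⟨b, hb, rfl⟩ h1 h2
      refine ⟨sub_lt_sub_right (hAB a ha b hb) _, fun h => hBL b hb ?_⟩
      simpa using hc _ _ h1 h2 h (by simpa using hAL a ha))
    refine ⟨x + w, fun a ha => ?_, fun b hb => ?_⟩
    · linarith [h1 _ ⟨a, ha, rfl⟩]
    · obtain ⟨a, ha, hxa⟩ := hx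
      linarith [h2 _ ⟨b, hb, rfl⟩ (sub_pos.2 (hxa.trans_lt (hAB a ha b hb)))]
  · obtain ⟨w, hw0, h1, h2⟩ := key (hB.image fun b => x - b) (hA.image fun a => x - a) (by
      rintro _ ⟨b, hb, rfl⟩ _ ⟨a, ha, rfl⟩ h1 h2
      refine ⟨sub_lt_sub_left (hAB a ha b hb) _, fun h => ?_⟩
      exact hc _ _ h1 h2 h (by simpa using hBL b hb) (by simpa using hAL a ha))
    refine ⟨x - w, fun a ha => ?_, fun b hb => ?_⟩
    · have hax : a < x := not_le.1 fun h => hx ⟨a, ha, h⟩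
      linarith [h2 _ ⟨a, ha, rfl⟩ (sub_pos.2 hax)]
    · linarith [h1 _ ⟨b, hb, rfl⟩]

end Hahn

end OrderedStructures

/-! ### The intermediate value property for Hahn series. -/

namespace OrderedStructures

open Polynomial

section HahnIVT

variable {G : Type*} [AddCommGroup G] [LinearOrder G] [IsOrderedAddMonoid G]

/-- Divisibility of `G` enters the intermediate value property only here: the balancing exponent is
a difference of valuations divided by `d`. -/
theorem exists_val_mul_pow_eq [DivisibleBy G ℕ] {a b : Lex (HahnSeries G ℝ)} (ha : 0 < a)
    (hb : 0 < b) {d : ℕ} (hd : d ≠ 0) : ∃ τ, 0 < τ ∧ val (b * τ ^ d) = val a := by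
  obtain ⟨α, hα⟩ := WithTop.ne_top_iff_exists.1 (mt val_eq_top.1 ha.ne')
  obtain ⟨β, hβ⟩ := WithTop.ne_top_iff_exists.1 (mt val_eq_top.1 hb.ne')
  refine ⟨mono (DivisibleBy.div (α - β) d) 1, mono_pos _ one_pos, ?_⟩
  have h1 : mono (DivisibleBy.div (α - β) d) 1 ^ d = mono (α - β) 1 := by
    refine (HahnSeries.single_pow _ d (1 : ℝ)).trans ?_
    rw [one_pow, DivisibleBy.div_cancel _ hd]
    rfl
  rw [h1, val_mul, val_mono _ one_ne_zero, ← hα, ← hβ, ← WithTop.coe_add, add_sub_cancel]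

/-- Let `τ` balance the two terms. The center property keeps the whole valuation class of `τ` on one
side of the cut, so `τ` can be multiplied or divided by an integer large enough to absorb the factor
`N`. -/
theorem dominates_or_dominates [DivisibleBy G ℕ] {L : Set (Lex (HahnSeries G ℝ))}
    {x : Lex (HahnSeries G ℝ)}
    (hc : ∀ y z, 0 < y → 0 < z → val y = val z → x + y ∈ L → x + z ∈ L)
    {a b : Lex (HahnSeries G ℝ)} (ha : 0 < a) (hb : 0 < b) {d : ℕ} (hd : d ≠ 0) {N : ℕ}
    (hN : 0 < N) :
    (∃ u, x + u ∉ L ∧ ∀ y, 0 < y → y ≤ u → N * (b * y ^ d) < a) ∨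
      (∃ l, 0 < l ∧ x + l ∈ L ∧ ∀ y, l ≤ y → N * a < b * y ^ d) := by
  obtain ⟨τ, hτ, hval⟩ := exists_val_mul_pow_eq ha hb hd
  have hbτ : 0 < b * τ ^ d := by positivity
  have hpow : ∀ {n : ℕ}, 0 < n → ∀ {t : Lex (HahnSeries G ℝ)}, 0 < t →
      n * t ^ d ≤ (n * t) ^ d := by
    intro n hn t ht
    rw [mul_pow]
    have h1 : (1 : Lex (HahnSeries G ℝ)) ≤ n := by exact_mod_cast hn
    gcongr
    exact le_self_pow₀ h1 hd
  by_cases hτL : x + τ ∈ L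
  · right
    obtain ⟨n, hn, h⟩ := exists_nat_mul_lt (x := (N : Lex (HahnSeries G ℝ)) * a) hbτ (by rw [val_natCast_mul hN, hval])
    have hn' : (0 : Lex (HahnSeries G ℝ)) < n := by exact_mod_cast hn
    refine ⟨n * τ, by positivity, hc τ _ hτ (by positivity) (val_natCast_mul hn τ).symm hτL,
      fun y hy => ?_⟩
    calc N * a < n * (b * τ ^ d) := h
      _ = b * (n * τ ^ d) := by ring
      _ ≤ b * (n * τ) ^ d := by gcongr; exact hpow hn hτ
      _ ≤ b * y ^ d := by gcongr
  · left
    obtain ⟨n, hn, h⟩ := exists_nat_mul_lt (x := (N : Lex (HahnSeries G ℝ)) * (b * τ ^ d)) ha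
      (by rw [val_natCast_mul hN, hval])
    have hn' : (0 : Lex (HahnSeries G ℝ)) < n := by exact_mod_cast hn
    have hτ' : n * (τ / n) = τ := mul_div_cancel₀ τ hn'.ne'
    have hpos : 0 < τ / n := by positivity
    refine ⟨τ / n, fun h' => hτL (hc _ τ hpos hτ ?_ h'), fun y hy0 hy => ?_⟩
    · conv_rhs => rw [← hτ', val_natCast_mul hn]
    · refine lt_of_mul_lt_mul_left (a := (n : Lex (HahnSeries G ℝ))) ?_ hn'.le
      calc n * (N * (b * y ^ d)) ≤ n * (N * (b * (τ / n) ^ d)) := by gcongr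
        _ = N * (b * (n * (τ / n) ^ d)) := by ring
        _ ≤ N * (b * (n * (τ / n)) ^ d) := by gcongr; exact hpow hn hpos
        _ = N * (b * τ ^ d) := by rw [hτ']
        _ < n * a := h

/-- The filter of the sets containing all positive `y` such that `x + y` is close to the cut
defined by `L`. -/
def nearCut {K : Type*} [Field K] [LinearOrder K] (L : Set K) (x : K) (hx : x ∈ L)
    (hL : ∃ u, x + u ∉ L) : Filter K where
  sets := {s | ∃ l u, 0 ≤ l ∧ x + l ∈ L ∧ x + u ∉ L ∧ ∀ y, 0 < y → l ≤ y → y ≤ u → y ∈ s}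
  univ_sets := by
    obtain ⟨u, hu⟩ := hL
    exact ⟨0, u, le_rfl, by simpa using hx, hu, fun _ _ _ _ => trivial⟩
  sets_of_superset := by
    rintro s t ⟨l, u, h0, hl, hu, h⟩ hst
    exact ⟨l, u, h0, hl, hu, fun y h1 h2 h3 => hst (h y h1 h2 h3)⟩
  inter_sets := by
    rintro s t ⟨l, u, h0, hl, hu, h⟩ ⟨l', u', h0', hl', hu', h'⟩
    refine ⟨max l l', min u u', le_max_of_le_left h0, ?_, ?_, fun y h1 h2 h3 =>
      ⟨h y h1 ((le_max_left _ _).trans h2) (h3.trans (min_le_left _ _)),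
        h' y h1 ((le_max_right _ _).trans h2) (h3.trans (min_le_right _ _))⟩⟩
    · rcases max_choice l l' with e | e <;> rw [e] <;> assumption
    · rcases min_choice u u' with e | e <;> rw [e] <;> assumption

theorem mul_pos_of_dominant_term {K : Type*} [Field K] [LinearOrder K] [IsStrictOrderedRing K]
    {ι : Type*} [DecidableEq ι] (s : Finset ι) (f : ι → K) {k : ι} (hk : k ∈ s)
    (h : ∀ i ∈ s, i ≠ k → (s.card : K) * |f i| < |f k|) (hfk : f k ≠ 0) :
    0 < (∑ i ∈ s, f i) * f k := by
  have hcard : 0 < (s.card : K) := by exact_mod_cast Finset.card_pos.2 ⟨k, hk⟩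
  have h1 : (s.card : K) * |∑ i ∈ s.erase k, f i| < s.card * |f k| := by
    calc (s.card : K) * |∑ i ∈ s.erase k, f i| ≤ s.card * ∑ i ∈ s.erase k, |f i| := by
          gcongr; exact Finset.abs_sum_le_sum_abs _ _
      _ = ∑ i ∈ s.erase k, s.card * |f i| := Finset.mul_sum _ _ _
      _ ≤ ∑ i ∈ s.erase k, |f k| := Finset.sum_le_sum fun i hi =>
          (h i (Finset.mem_of_mem_erase hi) (Finset.ne_of_mem_erase hi)).le
      _ = (s.erase k).card * |f k| := by rw [Finset.sum_const, nsmul_eq_mul]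
      _ < s.card * |f k| := by
          gcongr
          exact Finset.erase_ssubset hk
  have h2 := abs_lt.1 (lt_of_mul_lt_mul_left h1 hcard.le)
  rw [← Finset.add_sum_erase s f hk]
  rcases lt_or_gt_of_ne hfk with h0 | h0
  · rw [abs_of_neg h0] at h2
    exact mul_pos_of_neg_of_neg (by linarith [h2.2]) h0
  · rw [abs_of_pos h0] at h2
    exact mul_pos (by linarith [h2.1]) h0

/-- A polynomial does not change sign at a cut that has a center in its lower half. -/
theorem not_sign_change_of_center [DivisibleBy G ℕ] (f : (Lex (HahnSeries G ℝ))[X])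
    {L : Set (Lex (HahnSeries G ℝ))} (hL : IsLowerSet L) (hU : ∃ u, u ∉ L)
    {x : Lex (HahnSeries G ℝ)} (hx : x ∈ L)
    (hc : ∀ y z, 0 < y → 0 < z → val y = val z → x + y ∈ L → x + z ∈ L)
    (hneg : ∀ l ∈ L, ∃ l' ∈ L, l ≤ l' ∧ f.eval l' < 0)
    (hpos : ∀ u ∉ L, ∃ u' ∉ L, u' ≤ u ∧ 0 < f.eval u') : False := by
  have lt_of_mem : ∀ {a b}, a ∈ L → b ∉ L → a < b := fun ha hb =>
    not_le.1 fun h => hb (hL h ha)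
  set g := f.comp (X + C x) with hg
  have hgeval : ∀ y, g.eval y = f.eval (x + y) := by intro y; simp [hg, add_comm]
  have hU' : ∃ u, x + u ∉ L := by
    obtain ⟨u, hu⟩ := hU
    exact ⟨u - x, by simpa using hu⟩
  have hg0 : g ≠ 0 := by
    intro h0
    obtain ⟨l', -, -, h⟩ := hneg x hx
    have := hgeval (l' - x)
    rw [h0, eval_zero, add_sub_cancel] at this
    exact h.ne this.symm
  set S := g.support with hS
  set N := S.card with hN
  have hN0 : 0 < N := Finset.card_pos.2 (nonempty_support_iff.2 hg0)
  set F := nearCut L x hx hU' with hF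
  set m : ℕ → Lex (HahnSeries G ℝ) → Lex (HahnSeries G ℝ) := fun i y => g.coeff i * y ^ i with hm
  set Dom : ℕ → ℕ → Lex (HahnSeries G ℝ) → Prop := fun i j y => N * |m i y| < |m j y| with hDom
  -- The higher term can win only if `L` has points above `x`. This extra information settles the
  -- case where `x` is the greatest element of `L`.
  have hpair : ∀ i ∈ S, ∀ j ∈ S, i < j → (∀ᶠ y in F, Dom j i y) ∨
      ((∀ᶠ y in F, Dom i j y) ∧ ∃ l, 0 < l ∧ x + l ∈ L) := by
    intro i hi j hj hij
    have ha := abs_pos.2 (mem_support_iff.1 hi)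
    have hb := abs_pos.2 (mem_support_iff.1 hj)
    have hyj : ∀ y : Lex (HahnSeries G ℝ), 0 < y →
        |m j y| = |g.coeff j| * y ^ (j - i) * y ^ i ∧ |m i y| = |g.coeff i| * y ^ i := by
      intro y hy
      simp only [hm, abs_mul, abs_of_pos (pow_pos hy _), and_true]
      rw [mul_assoc, ← pow_add, Nat.sub_add_cancel hij.le]
    rcases dominates_or_dominates hc ha hb (Nat.sub_ne_zero_of_lt hij) hN0 with
      ⟨u, hu, h⟩ | ⟨l, hl, hlL, h⟩
    · refine Or.inl ⟨0, u, le_rfl, by simpa using hx, hu, fun y hy0 _ hyu => ?_⟩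
      have := mul_lt_mul_of_pos_right (h y hy0 hyu) (pow_pos hy0 i)
      simp only [hDom, Set.mem_ofPred_eq, hyj y hy0]
      linarith
    · obtain ⟨u, hu⟩ := hU'
      refine Or.inr ⟨⟨l, u, hl.le, hlL, hu, fun y hy0 hly _ => ?_⟩, l, hl, hlL⟩
      have := mul_lt_mul_of_pos_right (h y hly) (pow_pos hy0 i)
      simp only [hDom, Set.mem_ofPred_eq, hyj y hy0]
      linarith
  -- Finitely many eventual dominations hold on one common interval. The index of the largest term
  -- at its right end `u` is then never dominated, so it dominates every other.
  have hall : ∀ᶠ y in F, ∀ i ∈ S, ∀ j ∈ S, (∀ᶠ y in F, Dom i j y) → Dom i j y := by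
    rw [Filter.eventually_all_finset]
    intro i _
    rw [Filter.eventually_all_finset]
    intro j _
    by_cases h : ∀ᶠ y in F, Dom i j y
    · exact h.mono fun y hy _ => hy
    · exact Filter.Eventually.of_forall fun y h' => absurd h' h
  obtain ⟨l, u, hl0, hlL, huL, hlu⟩ := hall
  have hlu' : l < u := by simpa using lt_of_mem hlL huL
  have hu0 : 0 < u := hl0.trans_lt hlu'
  obtain ⟨k, hkS, hk⟩ := S.exists_max_image (fun i => |m i u|) (nonempty_support_iff.2 hg0)
  have hnot : ∀ i ∈ S, ¬ ∀ᶠ y in F, Dom k i y := by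
    intro i hi h
    have h1 := hlu u hu0 hlu'.le le_rfl k hkS i hi h
    have h2 := hk i hi
    have h3 : (1 : Lex (HahnSeries G ℝ)) ≤ N := by exact_mod_cast hN0
    have h4 := le_mul_of_one_le_left (abs_nonneg (m k u)) h3
    exact (h1.trans_le h2).not_ge h4
  have hdom : ∀ i ∈ S, i ≠ k → ∀ᶠ y in F, Dom i k y := by
    intro i hi hik
    rcases lt_or_gt_of_ne hik with h | h
    · exact ((hpair i hi k hkS h).resolve_left (hnot i hi)).1
    · exact (hpair k hkS i hi h).resolve_right fun h' => hnot i hi h'.1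
  have hsign : ∀ y, 0 < y → l ≤ y → y ≤ u → 0 < g.eval y * g.coeff k := by
    intro y hy0 h1 h2
    have h3 : 0 < (∑ i ∈ S, m i y) * m k y :=
      mul_pos_of_dominant_term S (fun i => m i y) hkS
        (fun i hi hik => hlu y hy0 h1 h2 i hi k hkS (hdom i hi hik))
        (mul_ne_zero (mem_support_iff.1 hkS) (pow_pos hy0 k).ne')
    have h4 : g.eval y = ∑ i ∈ S, m i y := by rw [eval_eq_sum]; rfl
    rw [← h4, hm, ← mul_assoc] at h3
    exact pos_of_mul_pos_left h3 (pow_pos hy0 k).le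
  have hkpos : 0 < g.coeff k := by
    obtain ⟨u', hu'L, hu', h⟩ := hpos _ huL
    have h1 : 0 < u' - x := sub_pos.2 (lt_of_mem hx hu'L)
    have h2 : l ≤ u' - x := by linarith [lt_of_mem hlL hu'L]
    have h3 := hsign (u' - x) h1 h2 (by linarith)
    rw [hgeval, add_sub_cancel] at h3
    exact (pos_iff_pos_of_mul_pos h3).1 h
  -- If nothing of `L` lies above `x`, the only negative value available is at `x` itself, the
  -- constant coefficient. By `hpair` no higher term can then dominate it, so it is the dominant
  -- term, but its sign is wrong.
  by_cases hex : ∃ y, 0 < y ∧ x + y ∈ L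
  · obtain ⟨y, hy0, hyL⟩ := hex
    have hmax : x + max l y ∈ L := by rcases max_choice l y with e | e <;> rw [e] <;> assumption
    obtain ⟨l', hl'L, hl', h⟩ := hneg _ hmax
    have h1 : max l y ≤ l' - x := by linarith
    have h3 := hsign (l' - x) ((hy0.trans_le (le_max_right _ _)).trans_le h1)
      ((le_max_left _ _).trans h1) (by linarith [lt_of_mem hl'L huL])
    rw [hgeval, add_sub_cancel] at h3
    exact ((pos_iff_pos_of_mul_pos h3).2 hkpos).not_gt h
  · obtain ⟨l', hl'L, hl', h⟩ := hneg _ hx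
    have hl'x : l' = x := le_antisymm (not_lt.1 fun h' => hex ⟨l' - x, sub_pos.2 h', by simpa⟩) hl'
    have h0 : g.coeff 0 = f.eval x := by rw [coeff_zero_eq_eval_zero, hgeval, add_zero]
    rw [hl'x, ← h0] at h
    rcases Nat.eq_zero_or_pos k with rfl | hk0
    · exact hkpos.not_gt h
    · rcases hpair 0 (mem_support_iff.2 h.ne) k hkS hk0 with h' | h'
      · exact hnot 0 (mem_support_iff.2 h.ne) h'
      · exact hex h'.2

/-- In the absence of a root, the points of the interval lying below some negative value form a cut
at which the polynomial changes sign. Such a cut has a center, which excludes the change. -/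
theorem polyIVT_hahn [DivisibleBy G ℕ] : PolyIVT (Lex (HahnSeries G ℝ)) := by
  intro f a b hab ha hb
  by_contra! hroot
  set L : Set (Lex (HahnSeries G ℝ)) := {y | ∃ l, a ≤ l ∧ l ≤ b ∧ f.eval l < 0 ∧ y ≤ l} with hLdef
  have hL : IsLowerSet L := fun y z hzy ⟨l, h1, h2, h3, h4⟩ => ⟨l, h1, h2, h3, hzy.trans h4⟩
  have haL : a ∈ L := ⟨a, le_rfl, hab.le, ha, le_rfl⟩
  have hbL : b ∉ L := by
    rintro ⟨l, h1, h2, h3, h4⟩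
    rw [le_antisymm h2 h4] at h3
    exact h3.not_gt hb
  have hneg : ∀ l ∈ L, ∃ l' ∈ L, l ≤ l' ∧ f.eval l' < 0 := by
    rintro l ⟨l', h1, h2, h3, h4⟩
    exact ⟨l', ⟨l', h1, h2, h3, le_rfl⟩, h4, h3⟩
  have hpos : ∀ u ∉ L, ∃ u' ∉ L, u' ≤ u ∧ 0 < f.eval u' := by
    intro u hu
    rcases le_or_gt u b with hub | hub
    · refine ⟨u, hu, le_rfl, ?_⟩
      have hau : a < u := not_le.1 fun h => hu (hL h haL)
      rcases hub.eq_or_lt with rfl | hub'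
      · exact hb
      · refine lt_of_le_of_ne (not_lt.1 fun h => hu ⟨u, hau.le, hub, h, le_rfl⟩) ?_
        exact (hroot u hau hub').symm
    · exact ⟨b, hbL, hub.le, hb⟩
  obtain ⟨x, ⟨hx, hc⟩ | ⟨hx, hc⟩⟩ := exists_center hL
  · exact not_sign_change_of_center f hL ⟨b, hbL⟩ hx hc hneg hpos
  -- The reflection `y ↦ -y` exchanges the halves of the cut and brings the center into the lower
  -- one.
  · refine not_sign_change_of_center (-f.comp (-X)) (L := {y | -y ∉ L}) (x := -x)
      (fun y z hzy hy h => hy (hL (neg_le_neg hzy) h)) ⟨-a, by simpa using haL⟩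
      (by simpa using hx) ?_ ?_ ?_
    · intro y z hy hz hyz h
      have := hc y z hy hz hyz (by simpa [sub_eq_add_neg, add_comm] using h)
      simpa [sub_eq_add_neg, add_comm] using this
    · intro l hl
      obtain ⟨u', h1, h2, h3⟩ := hpos _ hl
      exact ⟨-u', by simpa using h1, le_neg_of_le_neg h2, by simpa using h3⟩
    · intro u hu
      obtain ⟨l', h1, h2, h3⟩ := hneg (-u) (by simpa using hu)
      exact ⟨-l', by simpa using h1, neg_le_of_neg_le h2, by simpa using h3⟩

end HahnIVT

end OrderedStructures

/-! ### Separation of countable sets in the group. -/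

namespace OrderedStructures

open FirstOrder

section Group

variable {G : Type*} [AddCommGroup G] [LinearOrder G] [IsOrderedAddMonoid G]

theorem nsmul_div_two [DivisibleBy G ℕ] (g : G) :
    2 • (DivisibleBy.div g 2 : G) = g := DivisibleBy.div_cancel g two_ne_zero

theorem denselyOrdered_of_divisible [DivisibleBy G ℕ] : DenselyOrdered G where
  dense a b hab := by
    have h := nsmul_div_two (b - a)
    rw [two_nsmul] at h
    set c : G := DivisibleBy.div (b - a) 2
    have hc : 0 < c := by
      by_contra! hc
      have := add_nonpos hc hc
      rw [h] at this
      exact (sub_pos.2 hab).not_ge this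
    refine ⟨a + c, lt_add_of_pos_right a hc, ?_⟩
    have hb : b = a + c + c := by rw [add_assoc, h, add_sub_cancel]
    rw [hb]
    exact lt_add_of_pos_right _ hc

/-- The formula `x < y` in the language of ordered groups with parameters. -/
def ltFormula {A : Set G} {α : Type*} (s t : orderedGroupLang[[A]].Term α) :
    orderedGroupLang[[A]].Formula α :=
  Language.Relations.formula₂ (Sum.inl ltRel.lt : orderedGroupLang[[A]].Relations 2) s t

theorem realize_ltFormula {A : Set G} {α : Type*} (s t : orderedGroupLang[[A]].Term α)
    (v : α → G) : (ltFormula s t).Realize v ↔ s.realize v < t.realize v :=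
  Language.Formula.realize_rel₂.trans Iff.rfl

/-- The inequalities placing the variable above `A` and below `B` form a type over a countable set.
Density of the order, from halving differences, makes it finitely satisfiable. -/
theorem countableCutProperty_of_isSaturated [Nontrivial G] [DivisibleBy G ℕ]
    (hG : IsSaturated (Cardinal.aleph 1) orderedGroupLang G) : CountableCutProperty G := by
  classical
  intro A B hA hB hAB
  have := denselyOrdered_of_divisible (G := G)
  have hcard : Cardinal.mk (A ∪ B : Set G) < Cardinal.aleph 1 := by
    rw [← Cardinal.succ_aleph0, Order.lt_succ_iff, Cardinal.le_aleph0_iff_set_countable]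
    exact hA.union hB
  let x₀ : orderedGroupLang[[(A ∪ B : Set G)]].Term (Fin 1) := Language.Term.var 0
  let con : (A ∪ B : Set G) → orderedGroupLang[[(A ∪ B : Set G)]].Term (Fin 1) :=
    fun g => Language.Constants.term (orderedGroupLang.con g)
  have hcon : ∀ g v, (con g).realize v = (g : G) := fun g v => by simp [con]
  let lower : Set (orderedGroupLang[[(A ∪ B : Set G)]].Formula (Fin 1)) :=
    {φ | ∃ g : (A ∪ B : Set G), (g : G) ∈ A ∧ φ = ltFormula (con g) x₀}
  let upper : Set (orderedGroupLang[[(A ∪ B : Set G)]].Formula (Fin 1)) :=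
    {φ | ∃ g : (A ∪ B : Set G), (g : G) ∈ B ∧ φ = ltFormula x₀ (con g)}
  obtain ⟨x, hx⟩ := hG (A ∪ B) hcard (lower ∪ upper) (by
    intro s hs
    -- choose finitely many parameters occurring in `s`
    have hfin : ∀ t : Finset (orderedGroupLang[[(A ∪ B : Set G)]].Formula (Fin 1)),
        (t : Set _) ⊆ lower ∪ upper → ∃ lo hi : Finset G, (↑lo ⊆ A ∧ ↑hi ⊆ B) ∧
          ∀ y, (∀ a ∈ lo, a < y) → (∀ b ∈ hi, y < b) → ∀ φ ∈ t, φ.Realize (fun _ => y) := by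
      intro t
      induction t using Finset.induction_on with
      | empty => exact fun _ => ⟨∅, ∅, by simp, by simp⟩
      | insert φ t _ ih =>
        intro ht
        rw [Finset.coe_insert, Set.insert_subset_iff] at ht
        obtain ⟨lo, hi, ⟨h1, h2⟩, h⟩ := ih ht.2
        rcases ht.1 with ⟨g, hg, rfl⟩ | ⟨g, hg, rfl⟩
        · refine ⟨insert ↑g lo, hi, ⟨?_, h2⟩, fun y hy1 hy2 ψ hψ => ?_⟩
          · rw [Finset.coe_insert]
            exact Set.insert_subset hg h1
          · rcases Finset.mem_insert.1 hψ with rfl | hψ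
            · rw [realize_ltFormula, hcon]
              exact hy1 _ (Finset.mem_insert_self _ _)
            · exact h y (fun a ha => hy1 a (Finset.mem_insert_of_mem ha)) hy2 ψ hψ
        · refine ⟨lo, insert ↑g hi, ⟨h1, ?_⟩, fun y hy1 hy2 ψ hψ => ?_⟩
          · rw [Finset.coe_insert]
            exact Set.insert_subset hg h2
          · rcases Finset.mem_insert.1 hψ with rfl | hψ
            · rw [realize_ltFormula, hcon]
              exact hy2 _ (Finset.mem_insert_self _ _)
            · exact h y hy1 (fun a ha => hy2 a (Finset.mem_insert_of_mem ha)) ψ hψ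
    obtain ⟨lo, hi, ⟨h1, h2⟩, h⟩ := hfin s hs
    -- Either finite set may be empty; a nontrivial ordered group has no end points.
    obtain ⟨y, hy1, hy2⟩ := Order.exists_between_finsets lo hi
      fun a ha b hb => hAB a (h1 ha) b (h2 hb)
    exact ⟨y, h y hy1 hy2⟩)
  refine ⟨x, fun a ha => ?_, fun b hb => ?_⟩
  · have := hx (ltFormula (con ⟨a, Or.inl ha⟩) x₀) (Or.inl ⟨⟨a, Or.inl ha⟩, ha, rfl⟩)
    rw [realize_ltFormula, hcon] at this
    exact this
  · have := hx (ltFormula x₀ (con ⟨b, Or.inr hb⟩)) (Or.inr ⟨⟨b, Or.inr hb⟩, hb, rfl⟩)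
    rw [realize_ltFormula, hcon] at this
    exact this

end Group

end OrderedStructures

theorem lemma1p2 (G : Type*) [AddCommGroup G] [LinearOrder G] [IsOrderedAddMonoid G]
    [Nontrivial G] [DivisibleBy G ℕ]
    (hG : OrderedStructures.IsSaturated (Cardinal.aleph 1)
      OrderedStructures.orderedGroupLang G) :
    IsRealClosed (Lex (HahnSeries G ℝ)) ∧
      OrderedStructures.IsSaturated (Cardinal.aleph 1)
        OrderedStructures.orderedRingLang (Lex (HahnSeries G ℝ)) :=
  ⟨OrderedStructures.polyIVT_hahn.isRealClosed,
    OrderedStructures.isSaturated_of_countableCutProperty OrderedStructures.polyIVT_hahn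
      (OrderedStructures.countableCutProperty_hahn
        (OrderedStructures.countableCutProperty_of_isSaturated hG))⟩
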